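/- There are $n\ge 1$ agents and a set $I$ of $m=kn$ items, $k \ge 0$; each agent $a$ has a strict linear order $P_a$ over $I$. A policy is a sequence of $m$ turns, each assigned to an agent; along the sequence, the agent whose turn it is picks her most preferred item among those not yet allocated. A policy is balanced if all agents have the same number of turns (that is, $k$ turns each). Consider the following two decision problems, in which $n$ and $k$ are part of the input (in particular $k$ is not a fixed constant). - NecessarySet for balanced policies: given $n$, $k$, the preference profile $P$, a distinguished agent $a$ and a set $I'\subseteq I$, does $a$ get exactly the set $I'$ under every balanced policy? - Top-$k$ NecessarySet for balanced policies: given $n$, $k$, $P$ and $a$, does $a$ get exactly the set of her $k$ most preferred items under every balanced policy? Theorem. Both problems are solvable in polynomial time: each is decided by a Turing machine whose number of steps is bounded by a polynomial in the length of the encoded instance. -/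

import Mathlib

namespace SeqAlloc

/-! ### Sequential allocation -/

/-- A preference profile of `n` agents over `m` items. The linear order of agent `a` is given by
its ranking: `P a r` is the item that agent `a` ranks at position `r` (position `0` is the most
preferred one). The bijections of positions onto items are exactly the linear orders. -/
abbrev Profile (n m : ℕ) : Type := Fin n → Equiv.Perm (Fin m)

/-- The item that agent `a` prefers most among those in `S` (`none` if `S` is empty). -/
def favourite {n m : ℕ} (P : Profile n m) (a : Fin n) (S : Finset (Fin m)) : Option (Fin m) :=
  ((List.finRange m).map (P a)).find? (fun o => decide (o ∈ S))

/-- The picks (agent, item) made along a sequence of turns if the items of `S` are still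
unallocated: at her turn an agent takes her most preferred unallocated item. -/
def picks {n m : ℕ} (P : Profile n m) :
    List (Fin n) → Finset (Fin m) → List (Fin n × Fin m)
  | [], _ => []
  | a :: π, S =>
    match favourite P a S with
    | none => []
    | some o => (a, o) :: picks P π (S.erase o)

/-- The set of items that agent `a` gets under the policy `π`, all items being available at the
start. -/
def bundle {n m : ℕ} (P : Profile n m) (π : List (Fin n)) (a : Fin n) : Finset (Fin m) :=
  Finset.univ.filter (fun o => (a, o) ∈ picks P π Finset.univ)

/-- The balanced policies for `n` agents and `m` items: sequences of `m` turns in which all agents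
have the same number of turns. -/
def balancedPolicies (n m : ℕ) : Set (List (Fin n)) :=
  {π | π.length = m ∧ ∀ a b : Fin n, π.count a = π.count b}

/-- The `k` items that agent `a` ranks highest. -/
def topItems {n m : ℕ} (P : Profile n m) (a : Fin n) (k : ℕ) : Finset (Fin m) :=
  Finset.univ.filter (fun o => ((P a).symm o : ℕ) < k)

/-! ### The two decision problems -/

/-- An instance of top-`k` NecessarySet: `n` agents, `n * k` items, a profile and a distinguished
agent. The numbers `n` and `k` are part of the instance. -/
structure TopKInstance where
  n : ℕ
  k : ℕ
  P : Profile n (n * k)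
  agent : Fin n

/-- An instance of NecessarySet: in addition, a target set of items. -/
structure SetInstance extends TopKInstance where
  target : Finset (Fin (n * k))

/-- NecessarySet for balanced policies: does the distinguished agent get exactly the target set
under all balanced policies? -/
def NecessarySetBalanced (x : SetInstance) : Prop :=
  ∀ π ∈ balancedPolicies x.n (x.n * x.k), bundle x.P π x.agent = x.target

/-- Top-`k` NecessarySet for balanced policies: does the distinguished agent get exactly the set of
her `k` most preferred items under all balanced policies? -/
def TopKNecessarySetBalanced (x : TopKInstance) : Prop :=
  ∀ π ∈ balancedPolicies x.n (x.n * x.k), bundle x.P π x.agent = topItems x.P x.agent x.k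

/-! ### Encoding of the instances as bit strings

The names of agents and items are self-delimiting numbers written with tally marks. As each number
in an instance is at most the number of agents or the number of items, and every agent comes with
the list of all the items, this is polynomially related to writing them in binary. -/

/-- The number `i` as `i` ones followed by a zero. -/
def encodeNum (i : ℕ) : List Bool := List.replicate i true ++ [false]

/-- `n`, `k`, then for every agent the list of all items from the best to the worst, then the
distinguished agent. -/
def TopKInstance.encode (x : TopKInstance) : List Bool :=
  encodeNum x.n ++ encodeNum x.k ++
    (List.finRange x.n).flatMap (fun a =>
      (List.finRange (x.n * x.k)).flatMap (fun r => encodeNum (x.P a r))) ++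
    encodeNum x.agent

/-- In addition, the indicator vector of the target set. -/
def SetInstance.encode (x : SetInstance) : List Bool :=
  x.toTopKInstance.encode ++
    (List.finRange (x.n * x.k)).map (fun o => decide (o ∈ x.target))

/-! ### Polynomial time -/

/-- The decision problem `L` on instances of type `Inst`, encoded as bit strings, is in P: a
multi-stack Turing machine which, on input `enc x`, halts after at most `p (length (enc x))` steps
for some fixed polynomial `p`, outputs the truth value of `L x`. -/
def InP {Inst : Type} (enc : Inst → List Bool) (L : Inst → Prop) : Prop :=
  ∃ f : Inst → Bool, (∀ x, f x = true ↔ L x) ∧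
    Nonempty (Turing.TM2ComputableInPolyTime enc Computability.encodeBool f)

end SeqAlloc

/-! Fix the distinguished agent `a` and let T be the set of her k top items. If `a` takes the first
k turns she gets T, so T is the only set that can be necessary. NecessarySet thus amounts to
comparing the target with T and solving the top-k problem (`exists_bundle_eq_topItems`,
`necessarySet_iff`).

The top-k problem is a matching problem (`exists_bundle_ne_topItems_iff`). If `a` can miss T, then
in the run of the others alone some agent `b` takes an item `t` of T (`mem_topItems_of_mem_picks`).
That run leaves k items, and `t` is not one of them, so an item `y` outside T is left. Whatever an
agent took she prefers to `y`, which yields k items better than `y` for each agent other than `a`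
and `b`, and `t` is better than `y` for `b`. Conversely, such an assignment for the agents other
than `a` and `b` need not come from a policy, but trading along cycles of favourites turns it into
one that leaves `y` (`exists_policy_of_injOn`). Let `b` and then `a` move last. If `a` got T, then
`b` would have taken `y` while `t`, which she prefers, was available.

There are polynomially many pairs `(b, y)`, and each asks for a bipartite matching. An auction
decides it: when an unassigned bidder has to bid although all her items cost at least the number of
edges, a gap in the prices exposes a violation of Hall's condition (`IsHistory.not_injOn`,
`matchable_iff`).

For the time bound, a small structured language on four stacks is compiled to stack machines
(`steps_of_exec`). The functions it computes in polynomial time on tree-encoded data (`PolyTime`)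
are closed under composition, pairing, case distinction and folds with polynomially bounded
intermediate values. The decision procedures are assembled from these operations. -/

namespace SeqAlloc

/-! ### A structured language for stack machines -/

/-- The contents of the four stacks of the machines considered here. -/
abbrev Stacks : Type := Fin 4 → List Bool

/-- Structured programs on four stacks of bits. Tests look at the top symbol of one stack. -/
inductive Prog : Type
  | push (k : Fin 4) (b : Bool)
  | pop (k : Fin 4)
  | seq (p q : Prog)
  | ite (k : Fin 4) (f : Option Bool → Bool) (p q : Prog)
  | loop (k : Fin 4) (f : Option Bool → Bool) (p : Prog)

/-- `Exec p s s' t`: the program `p` leads from `s` to `s'` in `t` steps. -/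
inductive Exec : Prog → Stacks → Stacks → ℕ → Prop
  | push (k b s) : Exec (.push k b) s (Function.update s k (b :: s k)) 1
  | pop (k s) : Exec (.pop k) s (Function.update s k (s k).tail) 1
  | seq {p q s s' s'' t t'} (h : Exec p s s' t) (h' : Exec q s' s'' t') :
      Exec (.seq p q) s s'' (t + t')
  | ite_true {k f p q s s' t} (hf : f (s k).head? = true) (h : Exec p s s' t) :
      Exec (.ite k f p q) s s' (1 + t)
  | ite_false {k f p q s s' t} (hf : f (s k).head? = false) (h : Exec q s s' t) :
      Exec (.ite k f p q) s s' (1 + t)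
  | loop_done {k f p s} (hf : f (s k).head? = false) : Exec (.loop k f p) s s 1
  | loop_step {k f p s s' s'' t t'} (hf : f (s k).head? = true) (h : Exec p s s' t)
      (h' : Exec (.loop k f p) s' s'' t') : Exec (.loop k f p) s s'' (1 + t + t')

/-! ### Compilation of structured programs into stack machines. -/

namespace Prog

/-- The labels of the stack machine that executes a program. -/
def Lbl : Prog → Type
  | push _ _ => Unit
  | pop _ => Unit
  | seq p q => p.Lbl ⊕ q.Lbl
  | ite _ _ p q => Option (p.Lbl ⊕ q.Lbl)
  | loop _ _ p => Option p.Lbl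

/-- A program has finitely many labels. -/
@[reducible] def lblFintype : (p : Prog) → Fintype p.Lbl
  | push _ _ => inferInstanceAs (Fintype Unit)
  | pop _ => inferInstanceAs (Fintype Unit)
  | seq p q => @instFintypeSum _ _ p.lblFintype q.lblFintype
  | ite _ _ p q => @instFintypeOption _ (@instFintypeSum _ _ p.lblFintype q.lblFintype)
  | loop _ _ p => @instFintypeOption _ p.lblFintype

/-- The label at which the execution of a program starts. -/
def entry : (p : Prog) → p.Lbl
  | push _ _ => ()
  | pop _ => ()
  | seq p _ => Sum.inl p.entry
  | ite _ _ _ _ => none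
  | loop _ _ _ => none

/-- The statement at a label of a program that is placed into a machine by `emb` and continues at
the label `ex` when it is done. -/
def code {Λ : Type} : (p : Prog) → (p.Lbl → Λ) → Λ → p.Lbl →
    Turing.TM2.Stmt (fun _ : Fin 4 => Bool) Λ Bool
  | push k b, _, ex, _ => .push k (fun _ => b) (.goto fun _ => ex)
  | pop k, _, ex, _ => .pop k (fun v _ => v) (.goto fun _ => ex)
  | seq p q, emb, _, .inl l => p.code (fun l => emb (.inl l)) (emb (.inr q.entry)) l
  | seq _ q, emb, ex, .inr l => q.code (fun l => emb (.inr l)) ex l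
  -- A branch can inspect only the register, so the outcome of the test on the stack is first stored
  -- there.
  | ite k f p q, emb, _, none => .peek k (fun _ o => f o) (.branch id
      (.goto fun _ => emb (some (.inl p.entry))) (.goto fun _ => emb (some (.inr q.entry))))
  | ite _ _ p _, emb, ex, some (.inl l) => p.code (fun l => emb (some (.inl l))) ex l
  | ite _ _ _ q, emb, ex, some (.inr l) => q.code (fun l => emb (some (.inr l))) ex l
  | loop k f p, emb, ex, none => .peek k (fun _ o => f o) (.branch id
      (.goto fun _ => emb (some p.entry)) (.goto fun _ => ex))
  | loop _ _ p, emb, _, some l => p.code (fun l => emb (some l)) (emb none) l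

/-- The machine leads from one configuration to another in the given number of steps. -/
def Steps {Λ : Type} (M : Λ → Turing.TM2.Stmt (fun _ : Fin 4 => Bool) Λ Bool) (t : ℕ)
    (c c' : Turing.TM2.Cfg (fun _ : Fin 4 => Bool) Λ Bool) : Prop :=
  (flip bind (Turing.TM2.step M))^[t] (some c) = some c'

theorem Steps.trans {Λ : Type} {M : Λ → Turing.TM2.Stmt (fun _ : Fin 4 => Bool) Λ Bool} {t t' : ℕ}
    {c c' c'' : Turing.TM2.Cfg (fun _ : Fin 4 => Bool) Λ Bool} (h : Steps M t c c')
    (h' : Steps M t' c' c'') : Steps M (t + t') c c'' := by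
  unfold Steps at *
  rw [Nat.add_comm, Function.iterate_add_apply, h, h']

theorem Steps.single {Λ : Type} {M : Λ → Turing.TM2.Stmt (fun _ : Fin 4 => Bool) Λ Bool}
    {l : Λ} {q : Turing.TM2.Stmt (fun _ : Fin 4 => Bool) Λ Bool} {v : Bool} {s : Stacks}
    {c' : Turing.TM2.Cfg (fun _ : Fin 4 => Bool) Λ Bool} (hM : M l = q)
    (h : Turing.TM2.stepAux q v s = c') : Steps M 1 ⟨some l, v, s⟩ c' := by
  subst hM h
  rfl

/-- A subprogram occupies part of a larger machine, hence the induction over all embeddings `emb`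
and exits `ex`. The final register is existential because tests overwrite it; every test stores a
fresh value, so the initial one does not matter. -/
theorem steps_of_exec {Λ : Type} {M : Λ → Turing.TM2.Stmt (fun _ : Fin 4 => Bool) Λ Bool}
    {p : Prog} {s s' : Stacks} {t : ℕ} (h : Exec p s s' t) :
    ∀ (emb : p.Lbl → Λ) (ex : Λ), (∀ l, M (emb l) = p.code emb ex l) → ∀ v,
      ∃ v', Steps M t ⟨some (emb p.entry), v, s⟩ ⟨some ex, v', s'⟩ := by
  induction h with
  | push k b s =>
    intro emb ex hM v
    exact ⟨v, Steps.single (hM ()) rfl⟩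
  | pop k s =>
    intro emb ex hM v
    exact ⟨v, Steps.single (hM ()) rfl⟩
  | @seq p q s s' s'' t t' h h' ih ih' =>
    intro emb ex hM v
    obtain ⟨v₁, h₁⟩ := ih (fun l => emb (.inl l)) (emb (.inr q.entry)) (fun l => hM (.inl l)) v
    obtain ⟨v₂, h₂⟩ := ih' (fun l => emb (.inr l)) ex (fun l => hM (.inr l)) v₁
    exact ⟨v₂, h₁.trans h₂⟩
  | @ite_true k f p q s s' t hf h ih =>
    intro emb ex hM v
    obtain ⟨v₁, h₁⟩ := ih (fun l => emb (some (.inl l))) ex (fun l => hM (some (.inl l))) true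
    exact ⟨v₁, (Steps.single (hM none) (by simp [code, hf])).trans h₁⟩
  | @ite_false k f p q s s' t hf h ih =>
    intro emb ex hM v
    obtain ⟨v₁, h₁⟩ := ih (fun l => emb (some (.inr l))) ex (fun l => hM (some (.inr l))) false
    exact ⟨v₁, (Steps.single (hM none) (by simp [code, hf])).trans h₁⟩
  | @loop_done k f p s hf =>
    intro emb ex hM v
    exact ⟨false, Steps.single (hM none) (by simp [code, hf])⟩
  | @loop_step k f p s s' s'' t t' hf h h' ih ih' =>
    intro emb ex hM v
    obtain ⟨v₁, h₁⟩ := ih (fun l => emb (some l)) (emb none) (fun l => hM (some l)) true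
    obtain ⟨v₂, h₂⟩ := ih' emb ex hM v₁
    exact ⟨v₂, ((Steps.single (hM none) (by simp [code, hf])).trans
      h₁).trans h₂⟩

/-- The statements of the machine that executes a program and halts. -/
def machine (p : Prog) : Option p.Lbl → Turing.TM2.Stmt (fun _ : Fin 4 => Bool) (Option p.Lbl) Bool
  -- A halting configuration must have the initial register value, which the tests may have changed.
  -- This reset is the extra step in `toTM_outputs`.
  | none => .load (fun _ => false) .halt
  | some l => p.code some none l

/-- The Turing machine that executes a program, with input and output on the second stack. -/
def toTM (p : Prog) : Turing.FinTM2 where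
  K := Fin 4
  k₀ := 1
  k₁ := 1
  Γ _ := Bool
  Λ := Option p.Lbl
  main := some p.entry
  ΛFin := @instFintypeOption _ p.lblFintype
  σ := Bool
  initialState := false
  Γk₀Fin := inferInstanceAs (Fintype Bool)
  m := p.machine

/-- The stacks given by their four contents. -/
def stk (S A B C : List Bool) : Stacks := ![S, A, B, C]

theorem toTM_outputs (p : Prog) {l l' : List Bool} {t T : ℕ}
    (h : Exec p (stk [] l [] []) (stk [] l' [] []) t) (hT : t + 1 ≤ T) :
    Nonempty (Turing.TM2OutputsInTime p.toTM l (some l') T) := by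
  obtain ⟨v, hv⟩ := steps_of_exec (M := p.machine) h some none (fun _ => rfl) false
  have h2 : Steps p.machine 1 ⟨some none, v, stk [] l' [] []⟩ ⟨none, false, stk [] l' [] []⟩ :=
    Steps.single rfl rfl
  have h3 := hv.trans h2
  refine ⟨⟨⟨t + 1, ?_⟩, hT⟩⟩
  have e1 : Turing.initList p.toTM l = ⟨some (some p.entry), false, stk [] l [] []⟩ := by
    unfold Turing.initList
    congr 1
    funext k
    exact match k with
      | (0 : Fin 4) => rfl
      | (1 : Fin 4) => rfl
      | (2 : Fin 4) => rfl
      | (3 : Fin 4) => rfl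
  have e2 : Turing.haltList p.toTM l' = ⟨none, false, stk [] l' [] []⟩ := by
    unfold Turing.haltList
    congr 1
    funext k
    exact match k with
      | (0 : Fin 4) => rfl
      | (1 : Fin 4) => rfl
      | (2 : Fin 4) => rfl
      | (3 : Fin 4) => rfl
  rw [e1]
  exact Eq.trans h3 (congrArg some e2.symm)

end Prog

/-! ### Trees on stacks -/

/-- Binary trees, the data of polynomial-time functions. -/
inductive BTree : Type
  | nil
  | node (l r : BTree)

/-- The prefix notation of a tree. -/
def BTree.bits : BTree → List Bool
  | nil => [false]
  | node l r => true :: (l.bits ++ r.bits)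

/-- A step adds at most one symbol, so running time bounds output size. This is how
`PolyTime.size_le` obtains size bounds for compositions. -/
theorem exec_length {p : Prog} {s s' : Stacks} {t : ℕ} (h : Exec p s s' t) :
    ∑ k, (s' k).length ≤ ∑ k, (s k).length + t := by
  have key : ∀ (s : Stacks) (k : Fin 4) (l : List Bool), l.length ≤ (s k).length + 1 →
      ∑ j, (Function.update s k l j).length ≤ ∑ j, (s j).length + 1 := by
    intro s k l hl
    rw [← Finset.add_sum_erase _ _ (Finset.mem_univ k),
      ← Finset.add_sum_erase _ (fun j => (s j).length) (Finset.mem_univ k)]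
    have : ∑ x ∈ Finset.univ.erase k, (Function.update s k l x).length =
        ∑ x ∈ Finset.univ.erase k, (s x).length :=
      Finset.sum_congr rfl fun x hx => by rw [Function.update_of_ne (Finset.ne_of_mem_erase hx)]
    rw [this, Function.update_self]
    omega
  induction h with
  | push k b s => exact key _ _ _ (by simp)
  | pop k s => exact key _ _ _ (by simp; omega)
  | seq _ _ ih ih' => omega
  | ite_true _ _ ih => omega
  | ite_false _ _ ih => omega
  | loop_done _ => omega
  | loop_step _ _ _ ih ih' => omega

/-- The program `p` leads from `s` to `s'` in at most `T` steps. -/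
def Runs (p : Prog) (s s' : Stacks) (T : ℕ) : Prop := ∃ t ≤ T, Exec p s s' t

/-! ### Rules for running times. -/

namespace Runs

theorem seq {p q : Prog} {s s' s'' : Stacks} {T T' : ℕ} (h : Runs p s s' T)
    (h' : Runs q s' s'' T') : Runs (.seq p q) s s'' (T + T') := by
  obtain ⟨t, ht, h⟩ := h
  obtain ⟨t', ht', h'⟩ := h'
  exact ⟨_, Nat.add_le_add ht ht', h.seq h'⟩

theorem mono {p : Prog} {s s' : Stacks} {T T' : ℕ} (h : Runs p s s' T) (hT : T ≤ T') :
    Runs p s s' T' := by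
  obtain ⟨t, ht, h⟩ := h
  exact ⟨t, ht.trans hT, h⟩

theorem ite_true {k f p q s s' T} (hf : f (s k).head? = true) (h : Runs p s s' T) :
    Runs (.ite k f p q) s s' (1 + T) := by
  obtain ⟨t, ht, h⟩ := h
  exact ⟨_, Nat.add_le_add_left ht 1, .ite_true hf h⟩

theorem ite_false {k f p q s s' T} (hf : f (s k).head? = false) (h : Runs q s s' T) :
    Runs (.ite k f p q) s s' (1 + T) := by
  obtain ⟨t, ht, h⟩ := h
  exact ⟨_, Nat.add_le_add_left ht 1, .ite_false hf h⟩

theorem loop_done {k f p s} (hf : f (s k).head? = false) : Runs (.loop k f p) s s 1 :=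
  ⟨1, le_rfl, .loop_done hf⟩

theorem loop_step {k f p s s' s'' T T'} (hf : f (s k).head? = true) (h : Runs p s s' T)
    (h' : Runs (.loop k f p) s' s'' T') : Runs (.loop k f p) s s'' (1 + T + T') := by
  obtain ⟨t, ht, h⟩ := h
  obtain ⟨t', ht', h'⟩ := h'
  exact ⟨_, by omega, .loop_step hf h h'⟩

theorem push (k : Fin 4) (b : Bool) (s : Stacks) :
    Runs (.push k b) s (Function.update s k (b :: s k)) 1 := ⟨1, le_rfl, .push k b s⟩

theorem pop (k : Fin 4) (s : Stacks) :
    Runs (.pop k) s (Function.update s k (s k).tail) 1 := ⟨1, le_rfl, .pop k s⟩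

end Runs

/-! ### Moving, copying, exchanging and removing trees on stacks. -/

namespace Prog

section
variable (S A B C X : List Bool)

@[simp] theorem stk_zero : stk S A B C 0 = S := rfl
@[simp] theorem stk_one : stk S A B C 1 = A := rfl
@[simp] theorem stk_two : stk S A B C 2 = B := rfl
@[simp] theorem stk_three : stk S A B C 3 = C := rfl

@[simp] theorem update_stk_zero : Function.update (stk S A B C) 0 X = stk X A B C := by
  funext k; fin_cases k <;> rfl
@[simp] theorem update_stk_one : Function.update (stk S A B C) 1 X = stk S X B C := by
  funext k; fin_cases k <;> rfl
@[simp] theorem update_stk_two : Function.update (stk S A B C) 2 X = stk S A X C := by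
  funext k; fin_cases k <;> rfl
@[simp] theorem update_stk_three : Function.update (stk S A B C) 3 X = stk S A B X := by
  funext k; fin_cases k <;> rfl
end

/-- Test whether the top symbol is `true`. -/
def isTrue : Option Bool → Bool := fun o => o == some true

/-- Pour the stack `j` onto the stack `k`. -/
def pour (j k : Fin 4) : Prog :=
  loop j Option.isSome (ite j isTrue (seq (push k true) (pop j)) (seq (push k false) (pop j)))

theorem runs_pour {j k : Fin 4} (hjk : j ≠ k) (l : List Bool) : ∀ s : Stacks, s j = l →
    Runs (pour j k) s (Function.update (Function.update s k (l.reverse ++ s k)) j [])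
      (4 * l.length + 1) := by
  induction l with
  | nil =>
    intro s hs
    have : Function.update (Function.update s k (([] : List Bool).reverse ++ s k)) j [] = s := by
      funext i
      by_cases hi : i = j
      · subst hi; simp [hs]
      · by_cases hk : i = k
        · subst hk; simp [hi]
        · rw [Function.update_of_ne hi, Function.update_of_ne hk]
    rw [this]
    exact (Runs.loop_done (by simp [hs])).mono (by simp)
  | cons b l ih =>
    intro s hs
    set s₂ := Function.update (Function.update s k (b :: s k)) j l with hs₂
    have h2 := ih s₂ (by simp [hs₂])
    have e : Function.update (Function.update s₂ k (l.reverse ++ s₂ k)) j [] =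
        Function.update (Function.update s k ((b :: l).reverse ++ s k)) j [] := by
      funext i
      by_cases hi : i = j
      · subst hi; simp
      · by_cases hk : i = k
        · subst hk; simp [hi, hs₂]
        · simp [hi, hk, hs₂]
    rw [e] at h2
    have hb : Runs (seq (push k b) (pop j)) s s₂ (1 + 1) := by
      have h := (Runs.push k b s).seq (Runs.pop j _)
      rwa [Function.update_of_ne hjk, hs] at h
    refine (Runs.loop_step (T := 1 + (1 + 1)) (by simp [hs]) ?_ h2).mono
      (by simp only [List.length_cons]; omega)
    cases b
    · exact Runs.ite_false (by simp [hs, isTrue]) hb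
    · exact Runs.ite_true (by simp [hs, isTrue]) hb

/-- Move the topmost tree of the stack `0` in reverse to the stack `1`. -/
def moveLoop : Prog :=
  loop 3 Option.isSome (seq (pop 3) (ite 0 isTrue
    (seq (push 1 true) (seq (pop 0) (seq (push 3 true) (push 3 true))))
    (seq (push 1 false) (pop 0))))

/-- The stack `3` carries one mark for each subtree still to be read: a leaf uses up a mark, a node
exchanges one for two. The run after the tree is passed in as a hypothesis, so that in the induction
the run through the right subtree can be prefixed with that through the left one. -/
theorem runs_moveLoop (x : BTree) : ∀ (R A B C : List Bool) (s : Stacks) (T : ℕ),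
    Runs moveLoop (stk R (x.bits.reverse ++ A) B C) s T →
    Runs moveLoop (stk (x.bits ++ R) A B (true :: C)) s (T + 7 * x.bits.length) := by
  induction x with
  | nil =>
    intro R A B C s T h
    refine (Runs.loop_step (T := 1 + (1 + (1 + 1))) (by simp) ?_ h).mono
      (by simp [BTree.bits]; omega)
    refine Runs.seq (Runs.pop _ _) (Runs.ite_false (by simp [isTrue, BTree.bits]) ?_)
    simpa [BTree.bits] using
      (Runs.push 1 false (stk (BTree.nil.bits ++ R) A B C)).seq (Runs.pop 0 _)
  | node l r ihl ihr =>
    intro R A B C s T h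
    have h1 := ihr R (l.bits.reverse ++ true :: A) B C s T (by simpa [BTree.bits] using h)
    have h2 := ihl (r.bits ++ R) (true :: A) B (true :: C) s _ h1
    refine (Runs.loop_step (T := 1 + (1 + (1 + (1 + (1 + 1))))) (by simp) ?_ h2).mono
      (by simp [BTree.bits]; omega)
    refine Runs.seq (Runs.pop _ _) (Runs.ite_true (by simp [isTrue, BTree.bits]) ?_)
    simpa [BTree.bits] using
      (Runs.push 1 true (stk ((BTree.node l r).bits ++ R) A B C)).seq
        ((Runs.pop 0 _).seq ((Runs.push 3 true _).seq (Runs.push 3 true _)))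

/-- Move the topmost tree of the stack `0` in reverse to the stack `1`. -/
def move : Prog := seq (push 3 true) moveLoop

theorem runs_move (x : BTree) (R A B : List Bool) :
    Runs move (stk (x.bits ++ R) A B []) (stk R (x.bits.reverse ++ A) B [])
      (7 * x.bits.length + 2) := by
  have h := (Runs.push 3 true (stk (x.bits ++ R) A B [])).seq
    (q := moveLoop) (s'' := stk R (x.bits.reverse ++ A) B []) (T' := 1 + 7 * x.bits.length)
    (by simpa using runs_moveLoop x R A B [] _ 1 (Runs.loop_done (by simp)))
  exact h.mono (by omega)

/-- Pour the stack `1` onto the stacks `0` and `2`. -/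
def fork : Prog :=
  loop 1 Option.isSome (ite 1 isTrue (seq (push 0 true) (seq (push 2 true) (pop 1)))
    (seq (push 0 false) (seq (push 2 false) (pop 1))))

theorem runs_fork (l : List Bool) : ∀ (S B C : List Bool),
    Runs fork (stk S l B C) (stk (l.reverse ++ S) [] (l.reverse ++ B) C) (5 * l.length + 1) := by
  induction l with
  | nil => intro S B C; exact (Runs.loop_done (by simp)).mono (by simp)
  | cons b l ih =>
    intro S B C
    have h := ih (b :: S) (b :: B) C
    have hb : Runs (seq (push 0 b) (seq (push 2 b) (pop 1))) (stk S (b :: l) B C)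
        (stk (b :: S) l (b :: B) C) (1 + (1 + 1)) := by
      simpa using (Runs.push 0 b (stk S (b :: l) B C)).seq
        ((Runs.push 2 b _).seq (Runs.pop 1 _))
    rw [List.reverse_cons, List.append_assoc, List.append_assoc]
    refine (Runs.loop_step (T := 1 + (1 + (1 + 1))) (by simp) ?_ h).mono
      (by simp only [List.length_cons]; omega)
    cases b
    · exact Runs.ite_false (by simp [isTrue]) hb
    · exact Runs.ite_true (by simp [isTrue]) hb

/-- Duplicate the topmost tree. -/
def dup : Prog := seq move (seq fork (seq (pour 2 1) (pour 1 0)))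

theorem runs_dup (x : BTree) (R : List Bool) :
    Runs dup (stk (x.bits ++ R) [] [] []) (stk (x.bits ++ (x.bits ++ R)) [] [] [])
      (20 * x.bits.length + 5) := by
  have h1 := runs_move x R [] []
  have h2 := runs_fork (x.bits.reverse ++ []) R [] []
  have h3 := runs_pour (j := 2) (k := 1) (by decide) x.bits
    (stk (x.bits ++ R) [] x.bits []) rfl
  have h4 := runs_pour (j := 1) (k := 0) (by decide) x.bits.reverse
    (stk (x.bits ++ R) x.bits.reverse [] []) rfl
  simp only [List.append_nil, List.reverse_reverse, update_stk_one, update_stk_two,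
    update_stk_zero, stk_zero, stk_one, List.length_reverse] at h1 h2 h3 h4
  exact (h1.seq (h2.seq (h3.seq h4))).mono (by omega)

/-- Exchange the two topmost trees. -/
def swap : Prog :=
  seq move (seq (pour 1 2) (seq move (seq (pour 1 3) (seq (pour 2 1) (seq (pour 1 0)
    (seq (pour 3 1) (pour 1 0)))))))

theorem runs_swap (x y : BTree) (R : List Bool) :
    Runs swap (stk (x.bits ++ (y.bits ++ R)) [] [] []) (stk (y.bits ++ (x.bits ++ R)) [] [] [])
      (20 * (x.bits.length + y.bits.length) + 10) := by
  have h1 := runs_move x (y.bits ++ R) [] []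
  have h2 := runs_pour (j := 1) (k := 2) (by decide) x.bits.reverse
    (stk (y.bits ++ R) x.bits.reverse [] []) rfl
  have h3 := runs_move y R [] x.bits
  have h4 := runs_pour (j := 1) (k := 3) (by decide) y.bits.reverse
    (stk R y.bits.reverse x.bits []) rfl
  have h5 := runs_pour (j := 2) (k := 1) (by decide) x.bits (stk R [] x.bits y.bits) rfl
  have h6 := runs_pour (j := 1) (k := 0) (by decide) x.bits.reverse
    (stk R x.bits.reverse [] y.bits) rfl
  have h7 := runs_pour (j := 3) (k := 1) (by decide) y.bits (stk (x.bits ++ R) [] [] y.bits) rfl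
  have h8 := runs_pour (j := 1) (k := 0) (by decide) y.bits.reverse
    (stk (x.bits ++ R) y.bits.reverse [] []) rfl
  simp only [List.append_nil, List.reverse_reverse, update_stk_one, update_stk_two,
    update_stk_zero, update_stk_three, stk_zero, stk_one, stk_two, stk_three,
    List.length_reverse] at h1 h2 h3 h4 h5 h6 h7 h8
  exact (h1.seq (h2.seq (h3.seq (h4.seq (h5.seq (h6.seq (h7.seq h8))))))).mono (by omega)

/-- Remove the topmost tree. -/
def drop : Prog := seq move (loop 1 Option.isSome (pop 1))

theorem runs_drop (x : BTree) (R : List Bool) :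
    Runs drop (stk (x.bits ++ R) [] [] []) (stk R [] [] []) (9 * x.bits.length + 3) := by
  have key : ∀ l : List Bool, Runs (loop 1 Option.isSome (pop 1)) (stk R l [] [])
      (stk R [] [] []) (2 * l.length + 1) := by
    intro l
    induction l with
    | nil => exact Runs.loop_done (by simp)
    | cons b l ih =>
      have h := Runs.pop 1 (stk R (b :: l) [] [])
      simp only [update_stk_one, stk_one, List.tail_cons] at h
      exact (Runs.loop_step (by simp) h ih).mono (by simp only [List.length_cons]; omega)
  have h := (runs_move x R [] []).seq (key _)
  exact h.mono (by simp; omega)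

end Prog

/-! ### Polynomial-time functions on encoded data -/

/-- Types whose elements are encoded as trees. -/
class Enc (α : Type) where
  tree : α → BTree

/-- The bits of the encoding. -/
def bits {α : Type} [Enc α] (a : α) : List Bool := (Enc.tree a).bits

/-- The length of the encoding. -/
def size {α : Type} [Enc α] (a : α) : ℕ := (bits a).length

instance {α β : Type} [Enc α] [Enc β] : Enc (α × β) :=
  ⟨fun p => .node (Enc.tree p.1) (Enc.tree p.2)⟩
instance : Enc Bool := ⟨fun b => if b then .node .nil .nil else .nil⟩
instance : Enc Unit := ⟨fun _ => .nil⟩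

/-- The tree of a list, a right comb. -/
def listTree {α : Type} [Enc α] : List α → BTree
  | [] => .nil
  | a :: l => .node (Enc.tree a) (listTree l)

/-- A nonempty list has the bits of the pair of its head and tail, and a number those of a list of
units. Passing between these views therefore needs no computation (`PolyTime.of_bits_eq`). Numbers
are unary, which is harmless as instances are given in tally notation. -/
instance {α : Type} [Enc α] : Enc (List α) := ⟨listTree⟩
instance : Enc ℕ := ⟨fun n => listTree (List.replicate n ())⟩

section bits
variable {α β : Type} [Enc α] [Enc β]

theorem bits_pair (a : α) (b : β) : bits (a, b) = true :: (bits a ++ bits b) := rfl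
theorem bits_nil : bits ([] : List α) = [false] := rfl
theorem bits_cons (a : α) (l : List α) : bits (a :: l) = true :: (bits a ++ bits l) := rfl
theorem bits_false : bits false = [false] := rfl
theorem bits_true : bits true = [true, false, false] := rfl

theorem size_pair (a : α) (b : β) : size (a, b) = size a + size b + 1 := by
  simp [size, bits_pair]
theorem size_nil : size ([] : List α) = 1 := rfl
theorem size_cons (a : α) (l : List α) : size (a :: l) = size a + size l + 1 := by
  simp [size, bits_cons]
theorem size_bool_le (b : Bool) : size b ≤ 3 := by cases b <;> decide
theorem size_nat (n : ℕ) : size n = 2 * n + 1 := by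
  induction n with
  | zero => rfl
  | succ n ih =>
    have : size (n + 1) = size () + size n + 1 := size_cons () (List.replicate n ())
    rw [this, ih]
    have : size () = 1 := rfl
    omega
theorem size_pos (a : α) : 0 < size a := by
  unfold size bits
  cases Enc.tree a <;> simp [BTree.bits]
theorem length_le_size (l : List α) : l.length ≤ size l := by
  induction l with
  | nil => simp
  | cons a l ih => rw [size_cons]; simp; omega
end bits

/-- Coefficients are natural numbers, so time bounds may be evaluated at upper bounds of the true
sizes. -/
theorem eval_mono (T : Polynomial ℕ) {a b : ℕ} (h : a ≤ b) : T.eval a ≤ T.eval b := by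
  induction T using Polynomial.induction_on' with
  | add p q hp hq => simp only [Polynomial.eval_add]; omega
  | monomial n c => simp only [Polynomial.eval_monomial]; gcongr

/-- The function is computed by a program in polynomial time. -/
def PolyTime {α β : Type} [Enc α] [Enc β] (f : α → β) : Prop :=
  ∃ (p : Prog) (T : Polynomial ℕ), ∀ (a : α) (R : List Bool),
    Runs p (Prog.stk (bits a ++ R) [] [] []) (Prog.stk (bits (f a) ++ R) [] [] [])
      (T.eval (size a))

/-! ### Composition, pairing and case distinction in polynomial time. -/

namespace PolyTime

variable {α β γ δ : Type} [Enc α] [Enc β] [Enc γ] [Enc δ]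

theorem size_le {f : α → β} (hf : PolyTime f) :
    ∃ q : Polynomial ℕ, ∀ a, size (f a) ≤ q.eval (size a) := by
  obtain ⟨p, T, h⟩ := hf
  refine ⟨Polynomial.X + T, fun a => ?_⟩
  obtain ⟨t, ht, he⟩ := h a []
  have := exec_length he
  simp [Fin.sum_univ_four] at this
  simp only [Polynomial.eval_add, Polynomial.eval_X]
  unfold size at *
  omega

theorem of_bits_eq {f : α → β} {g : γ → δ} (hf : PolyTime f) (φ : γ → α)
    (h1 : ∀ c, bits c = bits (φ c)) (h2 : ∀ c, bits (g c) = bits (f (φ c))) : PolyTime g := by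
  obtain ⟨p, T, h⟩ := hf
  refine ⟨p, T, fun a R => ?_⟩
  have := h (φ a) R
  rwa [← h1, ← h2, size, ← h1] at this

theorem comp {g : β → γ} {f : α → β} (hg : PolyTime g) (hf : PolyTime f) :
    PolyTime fun a => g (f a) := by
  obtain ⟨q, hq⟩ := hf.size_le
  obtain ⟨p, T, h⟩ := hf
  obtain ⟨p', T', h'⟩ := hg
  refine ⟨.seq p p', T + T'.comp q, fun a R => ((h a R).seq (h' (f a) R)).mono ?_⟩
  simp only [Polynomial.eval_add, Polynomial.eval_comp]
  exact Nat.add_le_add_left (eval_mono _ (hq a)) _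

theorem id' : PolyTime fun a : α => a :=
  -- The language has no empty program; a push undone by a pop replaces it.
  ⟨.seq (.push 0 true) (.pop 0), Polynomial.C 2, fun a R => by
    simpa using (Runs.push 0 true (Prog.stk (bits a ++ R) [] [] [])).seq (Runs.pop 0 _)⟩

/-- The program that pushes a list of bits. -/
def _root_.SeqAlloc.Prog.pushAll : List Bool → Prog
  | [] => .seq (.push 0 true) (.pop 0)
  | b :: l => .seq (Prog.pushAll l) (.push 0 b)

theorem _root_.SeqAlloc.Prog.runs_pushAll (l R : List Bool) :
    Runs (Prog.pushAll l) (Prog.stk R [] [] []) (Prog.stk (l ++ R) [] [] []) (2 + l.length) := by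
  induction l with
  | nil =>
    simpa [Prog.pushAll] using (Runs.push 0 true (Prog.stk R [] [] [])).seq (Runs.pop 0 _)
  | cons b l ih => simpa [Prog.pushAll, Nat.add_assoc] using ih.seq (Runs.push 0 b _)

theorem const (b : β) : PolyTime fun _ : α => b := by
  refine ⟨.seq .drop (Prog.pushAll (bits b)),
    Polynomial.C 9 * Polynomial.X + Polynomial.C (5 + (bits b).length), fun a R => ?_⟩
  refine ((Prog.runs_drop (Enc.tree a) R).seq (Prog.runs_pushAll (bits b) R)).mono ?_
  simp only [Polynomial.eval_add, Polynomial.eval_mul, Polynomial.eval_C, Polynomial.eval_X]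
  simp only [size, bits]
  omega

/-- The arbitrary rest `R` in `PolyTime` is needed here: `f` runs above a saved copy of the
argument, and `g` above the result of `f`. The final push is the node bit of the pair. -/
theorem pair {f : α → β} {g : α → γ} (hf : PolyTime f) (hg : PolyTime g) :
    PolyTime fun a => (f a, g a) := by
  obtain ⟨qf, hqf⟩ := hf.size_le
  obtain ⟨qg, hqg⟩ := hg.size_le
  obtain ⟨p, T, h⟩ := hf
  obtain ⟨p', T', h'⟩ := hg
  refine ⟨.seq .dup (.seq p (.seq .swap (.seq p' (.seq .swap (.push 0 true))))),
    Polynomial.C 40 * Polynomial.X + T + T' + Polynomial.C 40 * qf + Polynomial.C 20 * qg +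
      Polynomial.C 26, fun a R => ?_⟩
  have h1 := Prog.runs_dup (Enc.tree a) R
  have h2 := h a (bits a ++ R)
  have h3 := Prog.runs_swap (Enc.tree (f a)) (Enc.tree a) R
  have h4 := h' a (bits (f a) ++ R)
  have h5 := Prog.runs_swap (Enc.tree (g a)) (Enc.tree (f a)) R
  have h6 := Runs.push 0 true (Prog.stk (bits (f a) ++ (bits (g a) ++ R)) [] [] [])
  simp only [Prog.update_stk_zero, Prog.stk_zero] at h6
  rw [bits_pair, List.cons_append, List.append_assoc]
  refine (h1.seq (h2.seq (h3.seq (h4.seq (h5.seq h6))))).mono ?_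
  simp only [Polynomial.eval_add, Polynomial.eval_mul, Polynomial.eval_C, Polynomial.eval_X]
  have := hqf a
  have := hqg a
  simp only [size, bits] at *
  omega

theorem fst : PolyTime (Prod.fst : α × β → α) := by
  refine ⟨.seq (.pop 0) (.seq .swap .drop), Polynomial.C 40 * Polynomial.X + Polynomial.C 14,
    fun a R => ?_⟩
  obtain ⟨a, b⟩ := a
  have h1 := Runs.pop 0 (Prog.stk (bits (a, b) ++ R) [] [] [])
  have h2 := Prog.runs_swap (Enc.tree a) (Enc.tree b) R
  have h3 := Prog.runs_drop (Enc.tree b) (bits a ++ R)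
  simp only [Prog.update_stk_zero, Prog.stk_zero, bits_pair, List.cons_append, List.tail_cons,
    List.append_assoc] at h1 ⊢
  refine (h1.seq (h2.seq h3)).mono ?_
  simp only [Polynomial.eval_add, Polynomial.eval_mul, Polynomial.eval_C, Polynomial.eval_X,
    size_pair]
  simp only [size, bits]
  omega

theorem snd : PolyTime (Prod.snd : α × β → β) := by
  refine ⟨.seq (.pop 0) .drop, Polynomial.C 9 * Polynomial.X + Polynomial.C 4,
    fun a R => ?_⟩
  obtain ⟨a, b⟩ := a
  have h1 := Runs.pop 0 (Prog.stk (bits (a, b) ++ R) [] [] [])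
  have h2 := Prog.runs_drop (Enc.tree a) (bits b ++ R)
  simp only [Prog.update_stk_zero, Prog.stk_zero, bits_pair, List.cons_append, List.tail_cons,
    List.append_assoc] at h1 ⊢
  refine (h1.seq h2).mono ?_
  simp only [Polynomial.eval_add, Polynomial.eval_mul, Polynomial.eval_C, Polynomial.eval_X,
    size_pair]
  simp only [size, bits]
  omega

theorem cons {f : α → β} {g : α → List β} (hf : PolyTime f) (hg : PolyTime g) :
    PolyTime fun a => f a :: g a :=
  (hf.pair hg).of_bits_eq id (fun _ => rfl) fun _ => rfl

/-- Branching on a condition. -/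
theorem cond {c : α → Bool} {f g : α → β} (hc : PolyTime c) (hf : PolyTime f) (hg : PolyTime g) :
    PolyTime fun a => if c a then f a else g a := by
  obtain ⟨p₀, T₀, h₀⟩ := hc
  obtain ⟨p, T, h⟩ := hf
  obtain ⟨p', T', h'⟩ := hg
  -- The encoding of `true` has three bits and that of `false` one, whence the different numbers of
  -- pops.
  refine ⟨.seq .dup (.seq p₀ (.ite 0 Prog.isTrue
    (.seq (.pop 0) (.seq (.pop 0) (.seq (.pop 0) p))) (.seq (.pop 0) p'))),
    Polynomial.C 20 * Polynomial.X + T₀ + T + T' + Polynomial.C 9, fun a R => ?_⟩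
  have h1 := Prog.runs_dup (Enc.tree a) R
  have h2 := h₀ a (bits a ++ R)
  by_cases hca : c a = true
  · simp only [hca, if_true, bits_true] at h2 ⊢
    have h3 := (Runs.pop 0 (Prog.stk ([true, false, false] ++ (bits a ++ R)) [] [] [])).seq
      ((Runs.pop 0 _).seq (Runs.seq (Runs.pop 0 _) (T' := T.eval (size a)) (q := p)
        (s'' := Prog.stk (bits (f a) ++ R) [] [] []) (by simpa using h a R)))
    refine (h1.seq (h2.seq (Runs.ite_true (by simp [Prog.isTrue]) h3))).mono ?_
    simp only [Polynomial.eval_add, Polynomial.eval_mul, Polynomial.eval_C, Polynomial.eval_X]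
    simp only [size, bits]
    omega
  · rw [Bool.not_eq_true] at hca
    simp only [hca, bits_false] at h2 ⊢
    have h3 := (Runs.pop 0 (Prog.stk ([false] ++ (bits a ++ R)) [] [] [])).seq
      (T' := T'.eval (size a)) (q := p')
        (s'' := Prog.stk (bits (g a) ++ R) [] [] []) (by simpa using h' a R)
    refine (h1.seq (h2.seq (Runs.ite_false (by simp [Prog.isTrue]) h3))).mono ?_
    simp only [Polynomial.eval_add, Polynomial.eval_mul, Polynomial.eval_C, Polynomial.eval_X]
    simp only [size, bits]
    omega

/-- Case distinction on a list. -/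
theorem list_cases {l : α → List β} {g : α → γ} {h : α × (β × List β) → γ} {f : α → γ}
    (hl : PolyTime l) (hg : PolyTime g) (hh : PolyTime h)
    (hnil : ∀ a, l a = [] → f a = g a) (hcons : ∀ a b t, l a = b :: t → f a = h (a, b, t)) :
    PolyTime f := by
  obtain ⟨q, hq⟩ := hl.size_le
  obtain ⟨p₀, T₀, h₀⟩ := hl
  obtain ⟨p, T, h⟩ := hg
  obtain ⟨p', T', h'⟩ := hh
  -- A nonempty list already is the pair of its head and tail; after the exchange with `a`, one node
  -- bit completes the triple `(a, b, t)`.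
  refine ⟨.seq .dup (.seq p₀ (.ite 0 Prog.isTrue
    (.seq .swap (.seq (.push 0 true) p')) (.seq (.pop 0) p))),
    Polynomial.C 40 * Polynomial.X + T₀ + T + T'.comp (Polynomial.X + q + 1) +
      Polynomial.C 20 * q + Polynomial.C 20, fun a R => ?_⟩
  have h1 := Prog.runs_dup (Enc.tree a) R
  have h2 := h₀ a (bits a ++ R)
  have hqa := hq a
  rcases hla : l a with _ | ⟨b, t⟩
  · rw [hnil a hla]
    simp only [hla, bits_nil] at h2
    have h3 := (Runs.pop 0 (Prog.stk ([false] ++ (bits a ++ R)) [] [] [])).seq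
      (T' := T.eval (size a)) (q := p)
        (s'' := Prog.stk (bits (g a) ++ R) [] [] []) (by simpa using h a R)
    refine (h1.seq (h2.seq (Runs.ite_false (by simp [Prog.isTrue]) h3))).mono ?_
    simp only [Polynomial.eval_add, Polynomial.eval_mul, Polynomial.eval_C, Polynomial.eval_X]
    simp only [size, bits]
    omega
  · rw [hcons a b t hla]
    rw [hla] at h2 hqa
    have h3 := Prog.runs_swap (Enc.tree (b, t)) (Enc.tree a) R
    have h4 := Runs.push 0 true (Prog.stk (bits a ++ (bits (b, t) ++ R)) [] [] [])
    simp only [Prog.update_stk_zero, Prog.stk_zero] at h4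
    have h5 := h' (a, b, t) R
    rw [bits_pair, List.cons_append, List.append_assoc] at h5
    have h6 := h3.seq (h4.seq h5)
    have hs : size (a, b, t) ≤ size a + q.eval (size a) + 1 := by
      rw [size_pair]
      have : size (b, t) = size (b :: t) := rfl
      omega
    have h7 := eval_mono T' hs
    refine (h1.seq (h2.seq (Runs.ite_true (by simp [Prog.isTrue, bits_cons]) h6))).mono ?_
    simp only [Polynomial.eval_add, Polynomial.eval_mul, Polynomial.eval_C, Polynomial.eval_X,
      Polynomial.eval_comp, Polynomial.eval_one]
    have : size (b :: t) = (Enc.tree (b, t)).bits.length := rfl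
    have : size a = (Enc.tree a).bits.length := rfl
    omega

end PolyTime

section size
variable {α β : Type} [Enc α] [Enc β]

theorem size_append (u v : List α) : size (u ++ v) + 1 = size u + size v := by
  induction u with
  | nil => simp [size_nil, Nat.add_comm]
  | cons a u ih => simp only [List.cons_append, size_cons]; omega

theorem size_mem_lt {a : α} {l : List α} (h : a ∈ l) : size a < size l := by
  induction l with
  | nil => simp at h
  | cons b l ih =>
    rw [size_cons]
    rcases List.mem_cons.1 h with rfl | h
    · omega
    · have := ih h; omega

theorem size_sublist {u v : List α} (h : u.Sublist v) : size u ≤ size v := by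
  induction h with
  | slnil => exact le_rfl
  | cons a _ ih => rw [size_cons]; omega
  | cons_cons a _ ih => rw [size_cons, size_cons]; omega

theorem size_reverse (u : List α) : size u.reverse = size u := by
  induction u with
  | nil => rfl
  | cons a u ih =>
    have := size_append u.reverse [a]
    rw [size_cons, size_nil] at this
    rw [List.reverse_cons, size_cons]
    omega

end size

/-! ### Folds, list operations and Boolean operations in polynomial time. -/

namespace PolyTime

variable {α β γ δ : Type} [Enc α] [Enc β] [Enc γ] [Enc δ]

/-- Iterating a polynomial-time step can make the data grow exponentially, so `hq` demands a
polynomial bound for every intermediate value. -/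
theorem foldl {l : α → List β} {s : α → γ} {f : α → γ → β → γ} (hl : PolyTime l)
    (hs : PolyTime s) (hf : PolyTime fun x : α × (γ × β) => f x.1 x.2.1 x.2.2)
    (hq : ∃ q : Polynomial ℕ, ∀ a u v, l a = u ++ v →
      size (u.foldl (f a) (s a)) ≤ q.eval (size a)) :
    PolyTime fun a => (l a).foldl (f a) (s a) := by
  have hinit : PolyTime fun a => (l a, (a, s a)) := hl.pair (id'.pair hs)
  have hstep : PolyTime fun x : List β × (α × γ) =>
      (match x.1 with
        | [] => x
        | b :: t => (t, (x.2.1, f x.2.1 x.2.2 b)) : List β × (α × γ)) := by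
    refine list_cases (l := Prod.fst) (g := id)
      (h := fun y : (List β × (α × γ)) × (β × List β) =>
        (y.2.2, (y.1.2.1, f y.1.2.1 y.1.2.2 y.2.1))) fst id' ?_ ?_ ?_
    · have h1 : PolyTime fun y : (List β × (α × γ)) × (β × List β) => y.1.2 := snd.comp fst
      have h2 : PolyTime fun y : (List β × (α × γ)) × (β × List β) => y.1.2.1 := fst.comp h1
      exact (snd.comp snd).pair (h2.pair (hf.comp (h2.pair ((snd.comp h1).pair (fst.comp snd)))))
    · rintro ⟨l, x⟩ h
      simp only at h
      subst h
      rfl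
    · rintro ⟨l, x⟩ b t h
      simp only at h
      subst h
      rfl
  obtain ⟨q, hq⟩ := hq
  obtain ⟨ql, hql⟩ := hl.size_le
  obtain ⟨p₀, T₀, h₀⟩ := hinit
  obtain ⟨p, T, h⟩ := hstep
  obtain ⟨p', T', h'⟩ := (snd : PolyTime (Prod.snd : α × γ → γ))
  -- The state is the triple of remaining list, argument and accumulator. Between rounds its node
  -- bit is removed, so that the top bit tells whether the remaining list is empty. The 3 in each
  -- round counts the test, the push and the pop.
  refine ⟨.seq p₀ (.seq (.pop 0) (.seq
    (.loop 0 Prog.isTrue (.seq (.push 0 true) (.seq p (.pop 0)))) (.seq (.pop 0) p'))),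
    T₀ + ql * (T.comp (ql + Polynomial.X + q + 2) + 3) + 3 + T'.comp (Polynomial.X + q + 1),
    fun a R => ?_⟩
  have key : ∀ v u, l a = u ++ v →
      Runs (.loop 0 Prog.isTrue (.seq (.push 0 true) (.seq p (.pop 0))))
        (Prog.stk (bits v ++ (bits (a, u.foldl (f a) (s a)) ++ R)) [] [] [])
        (Prog.stk (false :: (bits (a, (l a).foldl (f a) (s a)) ++ R)) [] [] [])
        (v.length * (T.eval (ql.eval (size a) + size a + q.eval (size a) + 2) + 3) + 1) := by
    intro v
    induction v with
    | nil =>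
      intro u hu
      rw [List.append_nil] at hu
      rw [← hu]
      exact (Runs.loop_done (by simp [Prog.isTrue, bits_nil])).mono (by simp)
    | cons b v ih =>
      intro u hu
      have h1 := Runs.push 0 true
        (Prog.stk (bits (b :: v) ++ (bits (a, u.foldl (f a) (s a)) ++ R)) [] [] [])
      simp only [Prog.update_stk_zero, Prog.stk_zero] at h1
      have h2 := h (b :: v, (a, u.foldl (f a) (s a))) R
      have hsz : size (b :: v, (a, u.foldl (f a) (s a))) ≤
          ql.eval (size a) + size a + q.eval (size a) + 2 := by
        have e1 := hql a
        have e2 := hq a u (b :: v) hu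
        rw [hu] at e1
        have e3 := size_append u (b :: v)
        have e4 := size_pos u
        rw [size_pair, size_pair]
        omega
      have h2 := h2.mono (eval_mono T hsz)
      rw [bits_pair, bits_pair (β := α × γ)] at h2
      simp only [List.cons_append, List.append_assoc] at h2
      have h3 := Runs.pop 0
        (Prog.stk (true :: (bits v ++ (bits (a, f a (u.foldl (f a) (s a)) b) ++ R))) [] [] [])
      simp only [Prog.update_stk_zero, Prog.stk_zero, List.tail_cons] at h3
      have h4 := ih (u ++ [b]) (by simp [hu])
      rw [List.foldl_append, List.foldl_cons, List.foldl_nil] at h4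
      refine (Runs.loop_step (by simp [Prog.isTrue, bits_cons]) (h1.seq (h2.seq h3)) h4).mono ?_
      rw [List.length_cons]
      ring_nf
      omega
  have h1 := h₀ a R
  rw [bits_pair, List.cons_append, List.append_assoc] at h1
  have h2 := Runs.pop 0 (Prog.stk (true :: (bits (l a) ++ (bits (a, s a) ++ R))) [] [] [])
  have h3 := key (l a) [] rfl
  have h4 := Runs.pop 0
    (Prog.stk (false :: (bits (a, (l a).foldl (f a) (s a)) ++ R)) [] [] [])
  simp only [Prog.update_stk_zero, Prog.stk_zero, List.tail_cons] at h2 h4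
  have h5 := h' (a, (l a).foldl (f a) (s a)) R
  have hsz : size (a, (l a).foldl (f a) (s a)) ≤ size a + q.eval (size a) + 1 := by
    have := hq a (l a) [] (by simp)
    rw [size_pair]
    omega
  refine (h1.seq (h2.seq (h3.seq (h4.seq h5)))).mono ?_
  have e1 := eval_mono T' hsz
  have e2 := Nat.mul_le_mul_right (T.eval (ql.eval (size a) + size a + q.eval (size a) + 2) + 3)
    ((length_le_size (l a)).trans (hql a))
  simp only [Polynomial.eval_add, Polynomial.eval_mul, Polynomial.eval_comp, Polynomial.eval_X,
    Polynomial.eval_one, Polynomial.eval_ofNat]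
  omega

theorem reverse {l : α → List β} (hl : PolyTime l) : PolyTime fun a => (l a).reverse := by
  have : PolyTime fun a => (l a).foldl (fun s b => b :: s) [] := by
    refine foldl (f := fun _ s b => b :: s) hl (const _) ?_ ?_
    · exact cons (snd.comp snd) (fst.comp snd)
    · obtain ⟨q, hq⟩ := hl.size_le
      refine ⟨q, fun a u v h => ?_⟩
      rw [List.foldl_flip_cons_eq_append', List.append_nil, size_reverse]
      refine le_trans (size_sublist ?_) (hq a)
      rw [h]
      exact List.sublist_append_left _ _
  simpa [List.foldl_flip_cons_eq_append'] using this

theorem foldr {l : α → List β} {s : α → γ} {f : α → β → γ → γ} (hl : PolyTime l)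
    (hs : PolyTime s) (hf : PolyTime fun x : α × (β × γ) => f x.1 x.2.1 x.2.2)
    (hq : ∃ q : Polynomial ℕ, ∀ a u v, l a = u ++ v →
      size (v.foldr (f a) (s a)) ≤ q.eval (size a)) :
    PolyTime fun a => (l a).foldr (f a) (s a) := by
  have : PolyTime fun a => (l a).reverse.foldl (fun s b => f a b s) (s a) := by
    refine foldl (f := fun a s b => f a b s) hl.reverse hs ?_ ?_
    · exact hf.comp (fst.pair ((snd.comp snd).pair (fst.comp snd)))
    · obtain ⟨q, hq⟩ := hq
      refine ⟨q, fun a u v h => ?_⟩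
      rw [List.reverse_eq_append_iff] at h
      have := hq a _ _ h
      rwa [List.foldr_reverse] at this
  simpa using this

/-- A fold in which each step adds a bounded amount of data. -/
theorem foldr_of_add {l : α → List β} {s : α → γ} {f : α → β → γ → γ} (hl : PolyTime l)
    (hs : PolyTime s) (hf : PolyTime fun x : α × (β × γ) => f x.1 x.2.1 x.2.2)
    (hq : ∃ q : Polynomial ℕ, ∀ a b c, b ∈ l a → size (f a b c) ≤ size c + q.eval (size a)) :
    PolyTime fun a => (l a).foldr (f a) (s a) := by
  obtain ⟨q, hq⟩ := hq
  obtain ⟨ql, hql⟩ := hl.size_le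
  obtain ⟨qs, hqs⟩ := hs.size_le
  refine foldr hl hs hf ⟨qs + ql * q, fun a u v h => ?_⟩
  have key : ∀ v : List β, (∀ b ∈ v, b ∈ l a) →
      size (v.foldr (f a) (s a)) ≤ size (s a) + v.length * q.eval (size a) := by
    intro v
    induction v with
    | nil => simp
    | cons b v ih =>
      intro hv
      have h1 := ih fun c hc => hv c (List.mem_cons_of_mem _ hc)
      have h2 := hq a b (v.foldr (f a) (s a)) (hv b List.mem_cons_self)
      rw [List.foldr_cons, List.length_cons, Nat.add_mul]
      omega
  have h1 := key v (fun b hb => by rw [h]; exact List.mem_append_right _ hb)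
  have h2 : v.length ≤ ql.eval (size a) := by
    have := length_le_size (l a)
    have := hql a
    have : v.length ≤ (l a).length := by rw [h]; simp
    omega
  have h3 := Nat.mul_le_mul_right (q.eval (size a)) h2
  have h4 := hqs a
  simp only [Polynomial.eval_add, Polynomial.eval_mul]
  omega

/-- A fold in which the amount of data stays bounded. -/
theorem foldr_of_bdd {l : α → List β} {s : α → γ} {f : α → β → γ → γ} (hl : PolyTime l)
    (hs : PolyTime s) (hf : PolyTime fun x : α × (β × γ) => f x.1 x.2.1 x.2.2) (N : ℕ)
    (hN : ∀ c : γ, size c ≤ N) : PolyTime fun a => (l a).foldr (f a) (s a) :=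
  foldr hl hs hf ⟨Polynomial.C N, fun a u v _ => by simpa using hN _⟩

theorem map {l : α → List β} {f : α → β → γ} (hl : PolyTime l)
    (hf : PolyTime fun x : α × β => f x.1 x.2) : PolyTime fun a => (l a).map (f a) := by
  have : PolyTime fun a => (l a).foldr (fun b c => f a b :: c) [] := by
    refine foldr_of_add (f := fun a b c => f a b :: c) hl (const _) ?_ ?_
    · exact cons (hf.comp (fst.pair (fst.comp snd))) (snd.comp snd)
    · obtain ⟨ql, hql⟩ := hl.size_le
      obtain ⟨q, hq⟩ := hf.size_le
      refine ⟨q.comp (Polynomial.X + ql + 1) + 1, fun a b c hb => ?_⟩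
      have h1 := size_mem_lt hb
      have h2 := hql a
      have h3 : size (f a b) ≤ _ := hq (a, b)
      have h4 : q.eval (size (a, b)) ≤ q.eval (size a + ql.eval (size a) + 1) :=
        eval_mono q (by rw [size_pair]; omega)
      simp only [Polynomial.eval_add, Polynomial.eval_comp, Polynomial.eval_X,
        Polynomial.eval_one, size_cons]
      omega
  simpa [← List.map_eq_foldr] using this

theorem append {u v : α → List β} (hu : PolyTime u) (hv : PolyTime v) :
    PolyTime fun a => u a ++ v a := by
  have : PolyTime fun a => (u a).foldr (fun b c => b :: c) (v a) := by
    refine foldr_of_add (f := fun _ b c => b :: c) hu hv (cons (fst.comp snd) (snd.comp snd)) ?_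
    obtain ⟨q, hq⟩ := hu.size_le
    refine ⟨q, fun a b c hb => ?_⟩
    have := size_mem_lt hb
    have := hq a
    rw [size_cons]
    omega
  simpa using this

theorem flatMap {l : α → List β} {f : α → β → List γ} (hl : PolyTime l)
    (hf : PolyTime fun x : α × β => f x.1 x.2) : PolyTime fun a => (l a).flatMap (f a) := by
  have : PolyTime fun a => (l a).foldr (fun b c => f a b ++ c) [] := by
    refine foldr_of_add (f := fun a b c => f a b ++ c) hl (const _) ?_ ?_
    · exact append (hf.comp (fst.pair (fst.comp snd))) (snd.comp snd)
    · obtain ⟨ql, hql⟩ := hl.size_le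
      obtain ⟨q, hq⟩ := hf.size_le
      refine ⟨q.comp (Polynomial.X + ql + 1), fun a b c hb => ?_⟩
      have h1 := size_mem_lt hb
      have h2 := hql a
      have h3 : size (f a b) ≤ _ := hq (a, b)
      have h4 : q.eval (size (a, b)) ≤ q.eval (size a + ql.eval (size a) + 1) :=
        eval_mono q (by rw [size_pair]; omega)
      have h5 := size_append (f a b) c
      simp only [Polynomial.eval_add, Polynomial.eval_comp, Polynomial.eval_X,
        Polynomial.eval_one]
      omega
  have e : ∀ a, (l a).foldr (fun b c => f a b ++ c) [] = (l a).flatMap (f a) := by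
    intro a
    induction l a with
    | nil => rfl
    | cons b t ih => simp [ih]
  simpa only [e] using this

theorem not {f : α → Bool} (hf : PolyTime f) : PolyTime fun a => !f a := by
  have := cond hf (const (α := α) false) (const true)
  refine this.of_bits_eq id (fun _ => rfl) fun a => ?_
  cases h : f a <;> simp [h]

theorem and {f g : α → Bool} (hf : PolyTime f) (hg : PolyTime g) :
    PolyTime fun a => f a && g a := by
  have := cond hf hg (const (α := α) false)
  refine this.of_bits_eq id (fun _ => rfl) fun a => ?_
  cases h : f a <;> simp [h]

theorem or {f g : α → Bool} (hf : PolyTime f) (hg : PolyTime g) :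
    PolyTime fun a => f a || g a := by
  have := cond hf (const (α := α) true) hg
  refine this.of_bits_eq id (fun _ => rfl) fun a => ?_
  cases h : f a <;> simp [h]

theorem beq_bool {f g : α → Bool} (hf : PolyTime f) (hg : PolyTime g) :
    PolyTime fun a => f a == g a := by
  have := cond hf hg hg.not
  refine this.of_bits_eq id (fun _ => rfl) fun a => ?_
  cases h : f a <;> simp [h]

theorem any {l : α → List β} {f : α → β → Bool} (hl : PolyTime l)
    (hf : PolyTime fun x : α × β => f x.1 x.2) : PolyTime fun a => (l a).any (f a) := by
  have : PolyTime fun a => (l a).foldr (fun b c => f a b || c) false :=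
    foldr_of_bdd (f := fun a b c => f a b || c) hl (const _)
      (or (hf.comp (fst.pair (fst.comp snd))) (snd.comp snd)) 3 size_bool_le
  have e : ∀ a, (l a).foldr (fun b c => f a b || c) false = (l a).any (f a) := by
    intro a
    induction l a with
    | nil => rfl
    | cons b t ih => simp [ih]
  simpa only [e] using this

theorem all {l : α → List β} {f : α → β → Bool} (hl : PolyTime l)
    (hf : PolyTime fun x : α × β => f x.1 x.2) : PolyTime fun a => (l a).all (f a) := by
  have := (any (f := fun a b => !f a b) hl hf.not).not
  refine this.of_bits_eq id (fun _ => rfl) fun a => ?_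
  rw [id, List.not_any_eq_all_not]
  simp

theorem filter {l : α → List β} {f : α → β → Bool} (hl : PolyTime l)
    (hf : PolyTime fun x : α × β => f x.1 x.2) : PolyTime fun a => (l a).filter (f a) := by
  have := flatMap (f := fun a b => if f a b then [b] else []) hl
    (cond hf (cons snd (const _)) (const _))
  refine this.of_bits_eq id (fun _ => rfl) fun a => ?_
  congr 1
  rw [id]
  induction l a with
  | nil => rfl
  | cons b t ih => cases h : f a b <;> simp [h, ih]

/-! #### Numbers -/

theorem replicate_unit {f : α → ℕ} (hf : PolyTime f) :
    PolyTime fun a => List.replicate (f a) () :=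
  hf.of_bits_eq id (fun _ => rfl) fun _ => rfl

theorem succ {f : α → ℕ} (hf : PolyTime f) : PolyTime fun a => f a + 1 :=
  (cons (const (α := α) ()) hf.replicate_unit).of_bits_eq id (fun _ => rfl) fun _ => rfl

theorem tail {l : α → List β} (hl : PolyTime l) : PolyTime fun a => (l a).tail :=
  list_cases hl (const []) (snd.comp snd) (fun a h => by rw [h]; rfl) fun a b t h => by
    rw [h]; rfl

theorem headD {l : α → List β} {d : α → β} (hl : PolyTime l) (hd : PolyTime d) :
    PolyTime fun a => (l a).headD (d a) :=
  list_cases hl hd (fst.comp snd) (fun a h => by rw [h]; rfl) fun a b t h => by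
    rw [h]; rfl

theorem isEmpty {l : α → List β} (hl : PolyTime l) : PolyTime fun a => (l a).isEmpty :=
  list_cases hl (const true) (const false) (fun a h => by rw [h]; rfl) fun a b t h => by
    rw [h]; rfl

theorem pred {f : α → ℕ} (hf : PolyTime f) : PolyTime fun a => f a - 1 :=
  hf.replicate_unit.tail.of_bits_eq id (fun _ => rfl) fun a => by
    rw [id, List.tail_replicate]; rfl

/-- A unary number is a list of units, so iteration is a fold over it. -/
theorem iterate {f : α → ℕ} {s : α → γ} {g : α → γ → γ} (hf : PolyTime f) (hs : PolyTime s)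
    (hg : PolyTime fun x : α × γ => g x.1 x.2)
    (hq : ∃ q : Polynomial ℕ, ∀ a n, n ≤ f a → size ((g a)^[n] (s a)) ≤ q.eval (size a)) :
    PolyTime fun a => (g a)^[f a] (s a) := by
  have e : ∀ a n, (List.replicate n ()).foldr (fun _ c => g a c) (s a) = (g a)^[n] (s a) := by
    intro a n
    induction n with
    | zero => rfl
    | succ n ih => rw [List.replicate_succ, List.foldr_cons, ih, Function.iterate_succ_apply']
  have : PolyTime fun a => (List.replicate (f a) ()).foldr (fun _ c => g a c) (s a) := by
    refine foldr (f := fun a _ c => g a c) hf.replicate_unit hs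
      (hg.comp (fst.pair (snd.comp snd))) ?_
    obtain ⟨q, hq⟩ := hq
    refine ⟨q, fun a u v h => ?_⟩
    have hv : v = List.replicate v.length () := by simp [List.eq_replicate_iff]
    rw [hv, e]
    refine hq a _ ?_
    have := congrArg List.length h
    simp at this
    omega
  simpa only [e] using this

theorem iterate_of_add {f : α → ℕ} {s : α → γ} {g : α → γ → γ} (hf : PolyTime f)
    (hs : PolyTime s) (hg : PolyTime fun x : α × γ => g x.1 x.2)
    (hq : ∃ q : Polynomial ℕ, ∀ a c, size (g a c) ≤ size c + q.eval (size a)) :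
    PolyTime fun a => (g a)^[f a] (s a) := by
  obtain ⟨q, hq⟩ := hq
  obtain ⟨ql, hql⟩ := hf.size_le
  obtain ⟨qs, hqs⟩ := hs.size_le
  refine iterate hf hs hg ⟨qs + ql * q, fun a n hn => ?_⟩
  have key : ∀ n, size ((g a)^[n] (s a)) ≤ size (s a) + n * q.eval (size a) := by
    intro n
    induction n with
    | zero => simp
    | succ n ih =>
      rw [Function.iterate_succ_apply', Nat.add_mul]
      have := hq a ((g a)^[n] (s a))
      omega
  have h1 := key n
  have h2 : n ≤ ql.eval (size a) := by
    have := hql a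
    rw [size_nat] at this
    omega
  have h3 := Nat.mul_le_mul_right (q.eval (size a)) h2
  have h4 := hqs a
  simp only [Polynomial.eval_add, Polynomial.eval_mul]
  omega

theorem add {f g : α → ℕ} (hf : PolyTime f) (hg : PolyTime g) : PolyTime fun a => f a + g a := by
  have : PolyTime fun a => (fun n => n + 1)^[g a] (f a) :=
    iterate_of_add (g := fun _ n => n + 1) hg hf (succ snd)
      ⟨2, fun a c => by simp only [size_nat, Polynomial.eval_ofNat]; omega⟩
  simpa using this

theorem mul {f g : α → ℕ} (hf : PolyTime f) (hg : PolyTime g) : PolyTime fun a => f a * g a := by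
  have : PolyTime fun a => (fun n => n + f a)^[g a] 0 := by
    refine iterate_of_add (g := fun a n => n + f a) hg (const 0) (add snd (hf.comp fst)) ?_
    obtain ⟨q, hq⟩ := hf.size_le
    refine ⟨q, fun a c => ?_⟩
    have := hq a
    simp only [size_nat] at *
    omega
  simpa [Nat.mul_comm] using this

theorem sub {f g : α → ℕ} (hf : PolyTime f) (hg : PolyTime g) : PolyTime fun a => f a - g a := by
  have : PolyTime fun a => (fun n => n - 1)^[g a] (f a) :=
    iterate_of_add (g := fun _ n => n - 1) hg hf (pred snd)
      ⟨0, fun a c => by simp only [size_nat]; omega⟩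
  have e : ∀ m n : ℕ, (fun n => n - 1)^[m] n = n - m := by
    intro m n
    induction m with
    | zero => rfl
    | succ m ih => rw [Function.iterate_succ_apply', ih]; rfl
  simpa only [e] using this

theorem le {f g : α → ℕ} (hf : PolyTime f) (hg : PolyTime g) :
    PolyTime fun a => decide (f a ≤ g a) := by
  have := (hf.sub hg).replicate_unit.isEmpty
  refine this.of_bits_eq id (fun _ => rfl) fun a => ?_
  congr 1
  rw [Bool.eq_iff_iff]
  simp [Nat.sub_eq_zero_iff_le]

theorem lt {f g : α → ℕ} (hf : PolyTime f) (hg : PolyTime g) :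
    PolyTime fun a => decide (f a < g a) :=
  le hf.succ hg

theorem eq {f g : α → ℕ} (hf : PolyTime f) (hg : PolyTime g) :
    PolyTime fun a => decide (f a = g a) := by
  refine ((hf.le hg).and (hg.le hf)).of_bits_eq id (fun _ => rfl) fun a => ?_
  congr 1
  rw [Bool.eq_iff_iff]
  simp [Nat.le_antisymm_iff]

theorem eq_pair {β γ : Type} [Enc β] [Enc γ] [DecidableEq β] [DecidableEq γ] {f g : α → β × γ}
    (h1 : PolyTime fun a => decide ((f a).1 = (g a).1))
    (h2 : PolyTime fun a => decide ((f a).2 = (g a).2)) :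
    PolyTime fun a => decide (f a = g a) := by
  refine (h1.and h2).of_bits_eq id (fun _ => rfl) fun a => ?_
  congr 1
  rw [Bool.eq_iff_iff]
  simp [Prod.ext_iff]

theorem length {l : α → List β} (hl : PolyTime l) : PolyTime fun a => (l a).length := by
  have : PolyTime fun a => (l a).foldr (fun _ n => n + 1) 0 :=
    foldr_of_add (f := fun _ _ n => n + 1) hl (const 0) (succ (snd.comp snd))
      ⟨2, fun a b c _ => by simp only [size_nat, Polynomial.eval_ofNat]; omega⟩
  have e : ∀ l : List β, l.foldr (fun _ n => n + 1) 0 = l.length := by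
    intro l
    induction l with
    | nil => rfl
    | cons b t ih => simp
  simpa only [e] using this

theorem range {f : α → ℕ} (hf : PolyTime f) : PolyTime fun a => List.range (f a) := by
  have e : ∀ n : ℕ, (fun u : List ℕ => u ++ [u.length])^[n] [] = List.range n := by
    intro n
    induction n with
    | zero => rfl
    | succ n ih => rw [Function.iterate_succ_apply', ih, List.range_succ, List.length_range]
  have hs : ∀ n : ℕ, size (List.range n) ≤ n * (2 * n + 2) + 1 := by
    intro n
    induction n with
    | zero => simp [size_nil]
    | succ n ih =>
      have := size_append (List.range n) [n]
      rw [size_cons, size_nil, size_nat] at this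
      rw [List.range_succ]
      nlinarith
  have : PolyTime fun a => (fun u : List ℕ => u ++ [u.length])^[f a] [] := by
    refine iterate (g := fun _ (u : List ℕ) => u ++ [u.length]) hf (const [])
      (append snd (cons (length snd) (const []))) ?_
    obtain ⟨q, hq⟩ := hf.size_le
    refine ⟨q * (2 * q + 2) + 1, fun a n hn => ?_⟩
    rw [e]
    refine (hs n).trans ?_
    have : n ≤ q.eval (size a) := by
      have := hq a
      rw [size_nat] at this
      omega
    simp only [Polynomial.eval_add, Polynomial.eval_mul, Polynomial.eval_one,
      Polynomial.eval_ofNat]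
    gcongr
  simpa only [e] using this

theorem drop {f : α → ℕ} {l : α → List β} (hf : PolyTime f) (hl : PolyTime l) :
    PolyTime fun a => (l a).drop (f a) := by
  have e : ∀ n (u : List β), (fun u : List β => u.tail)^[n] u = u.drop n := by
    intro n u
    induction n with
    | zero => rfl
    | succ n ih => rw [Function.iterate_succ_apply', ih, List.tail_drop]
  have : PolyTime fun a => (fun u : List β => u.tail)^[f a] (l a) :=
    iterate_of_add (g := fun _ (u : List β) => u.tail) hf hl (tail snd)
      ⟨0, fun a c => (size_sublist (List.tail_sublist c)).trans (Nat.le_add_right _ _)⟩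
  simpa only [e] using this

theorem getD {f : α → ℕ} {l : α → List β} {d : α → β} (hl : PolyTime l) (hf : PolyTime f)
    (hd : PolyTime d) : PolyTime fun a => (l a).getD (f a) (d a) := by
  have := (hf.drop hl).headD hd
  have e : ∀ n (u : List β) d, (u.drop n).headD d = u.getD n d := by
    intro n u d
    rw [List.headD_eq_head?_getD, List.head?_drop, List.getD_eq_getElem?_getD]
  simpa only [e] using this

theorem idxOf {l : α → List ℕ} {f : α → ℕ} (hf : PolyTime f) (hl : PolyTime l) :
    PolyTime fun a => (l a).idxOf (f a) := by
  have : PolyTime fun a => (l a).foldr (fun b n => if decide (b = f a) then 0 else n + 1) 0 := by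
    refine foldr_of_add (f := fun a b n => if decide (b = f a) then 0 else n + 1) hl (const 0)
      (cond (eq (fst.comp snd) (hf.comp fst)) (const 0) (succ (snd.comp snd)))
      ⟨2, fun a b c _ => ?_⟩
    simp only [Polynomial.eval_ofNat]
    split <;> simp only [size_nat] <;> omega
  refine this.of_bits_eq id (fun _ => rfl) fun a => ?_
  congr 1
  rw [id]
  induction l a with
  | nil => rfl
  | cons b t ih => 
    rw [List.idxOf_cons, List.foldr_cons, ← ih]
    by_cases h : b = f a
    · simp [h]
    · simp only [beq_eq_false_iff_ne.2 h, h, decide_false, cond_false]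
      rfl

end PolyTime

/-! ### Bipartite matching by an auction

A history is the list of all bids so far, the newest one first; a bid is an item with its bidder.
The owner of an item is the last one who bid for it, its price is the number of bids for it. -/

section auction

variable {ι σ : Type} [DecidableEq ι]

/-- The number of bids for an item. -/
def price (H : List (ι × σ)) (i : ι) : ℕ := (H.filter fun e => decide (e.1 = i)).length

theorem price_cons (e : ι × σ) (H : List (ι × σ)) (i : ι) :
    price (e :: H) i = (if e.1 = i then 1 else 0) + price H i := by
  by_cases h : e.1 = i <;> simp [price, h, Nat.add_comm]

theorem sum_price {H : List (ι × σ)} {I : Finset ι} (hI : ∀ e ∈ H, e.1 ∈ I) :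
    ∑ i ∈ I, price H i = H.length := by
  induction H with
  | nil => simp [price]
  | cons e H ih =>
    simp only [price_cons, Finset.sum_add_distrib, List.length_cons]
    rw [ih fun e' he' => hI e' (List.mem_cons_of_mem _ he'), Finset.sum_ite_eq,
      if_pos (hI e List.mem_cons_self), Nat.add_comm]

variable [DecidableEq σ]

/-- Whether the bidder `s` owns the item `i`. -/
def owns (H : List (ι × σ)) (i : ι) (s : σ) : Bool :=
  ((H.filter fun e => decide (e.1 = i)).take 1).any fun e => decide (e.2 = s)

/-- Whether the bidder `s` owns some item. -/
def assigned (H : List (ι × σ)) (s : σ) : Bool := H.any fun e => owns H e.1 s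

/-- A cheapest edge among the edges of unassigned bidders (none if there are no such edges). -/
def nextBid (E H : List (ι × σ)) : List (ι × σ) :=
  E.foldr (fun e o => if assigned H e.2 then o else
    if o.any (fun e' => decide (price H e'.1 < price H e.1)) then o else [e]) []

/-- The history after the next bid. -/
def bidStep (E H : List (ι × σ)) : List (ι × σ) := nextBid E H ++ H

/-- Whether there is an injective assignment of items to the bidders in `L` along the edges. -/
def matchable (L : List σ) (E : List (ι × σ)) : Bool :=
  -- At most `E.length` items occur, so this many bids push some price above `E.length`.
  L.all (assigned ((bidStep E)^[E.length * E.length + 1] []))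

theorem owns_cons_self (e : ι × σ) (H : List (ι × σ)) (s : σ) :
    owns (e :: H) e.1 s = decide (e.2 = s) := by
  simp [owns]

theorem owns_cons_of_ne (e : ι × σ) (H : List (ι × σ)) (i : ι) (s : σ) (h : e.1 ≠ i) :
    owns (e :: H) i s = owns H i s := by
  simp [owns, h]

theorem mem_of_owns {H : List (ι × σ)} {i : ι} {s : σ} (h : owns H i s = true) : (i, s) ∈ H := by
  rw [owns, List.any_eq_true] at h
  obtain ⟨e, he, hs⟩ := h
  have h1 := List.mem_filter.1 (List.mem_of_mem_take he)
  simp only [decide_eq_true_eq] at h1 hs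
  rw [← h1.2, ← hs]
  exact h1.1

theorem assigned_iff {H : List (ι × σ)} {s : σ} : assigned H s = true ↔ ∃ i, owns H i s = true := by
  rw [assigned, List.any_eq_true]
  exact ⟨fun ⟨e, _, h⟩ => ⟨e.1, h⟩, fun ⟨i, h⟩ => ⟨(i, s), mem_of_owns h, h⟩⟩

theorem exists_owner {H : List (ι × σ)} {i : ι} (h : 0 < price H i) : ∃ s, owns H i s = true := by
  unfold price at h
  unfold owns
  rcases hF : H.filter (fun e => decide (e.1 = i)) with _ | ⟨e, t⟩
  · simp [hF] at h
  · exact ⟨e.2, by rw [hF]; simp⟩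

theorem owner_unique {H : List (ι × σ)} {i : ι} {s s' : σ} (h : owns H i s = true)
    (h' : owns H i s' = true) : s = s' := by
  unfold owns at h h'
  rcases hF : H.filter (fun e => decide (e.1 = i)) with _ | ⟨e, t⟩
  · simp [hF] at h
  · simp [hF] at h h'
    rw [← h, ← h']

theorem nextBid_spec (E H : List (ι × σ)) :
    (nextBid E H = [] ∧ ∀ e ∈ E, assigned H e.2 = true) ∨
    ∃ e, nextBid E H = [e] ∧ e ∈ E ∧ assigned H e.2 = false ∧
      ∀ e' ∈ E, assigned H e'.2 = false → price H e.1 ≤ price H e'.1 := by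
  induction E with
  | nil => left; simp [nextBid]
  | cons f E ih =>
    have e0 : nextBid (f :: E) H = if assigned H f.2 then nextBid E H else
      if (nextBid E H).any (fun e' => decide (price H e'.1 < price H f.1)) then nextBid E H
        else [f] := rfl
    rw [e0]
    cases hf : assigned H f.2
    · right
      rcases ih with ⟨h1, h2⟩ | ⟨e, h1, h2, h3, h4⟩
      · refine ⟨f, by simp [h1], List.mem_cons_self, hf, fun e' he' h => ?_⟩
        rcases List.mem_cons.1 he' with rfl | he'
        · exact le_rfl
        · rw [h2 e' he'] at h; simp at h
      · by_cases hlt : price H e.1 < price H f.1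
        · refine ⟨e, by simp [h1, hlt], List.mem_cons_of_mem _ h2, h3, fun e' he' h => ?_⟩
          rcases List.mem_cons.1 he' with rfl | he'
          · exact hlt.le
          · exact h4 e' he' h
        · refine ⟨f, by simp [h1, hlt], List.mem_cons_self, hf, fun e' he' h => ?_⟩
          rcases List.mem_cons.1 he' with rfl | he'
          · exact le_rfl
          · exact (not_lt.1 hlt).trans (h4 e' he' h)
    · rcases ih with ⟨h1, h2⟩ | ⟨e, h1, h2, h3, h4⟩
      · left
        refine ⟨by simp [h1], fun e he => ?_⟩
        rcases List.mem_cons.1 he with rfl | he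
        · exact hf
        · exact h2 e he
      · right
        refine ⟨e, by simp [h1], List.mem_cons_of_mem _ h2, h3, fun e' he' h => ?_⟩
        rcases List.mem_cons.1 he' with rfl | he'
        · rw [hf] at h; simp at h
        · exact h4 e' he' h

/-- The histories of auctions in which unassigned bidders bid for items of minimal price. -/
inductive IsHistory (E : List (ι × σ)) : List (ι × σ) → Prop
  | nil : IsHistory E []
  | cons {e H} (hH : IsHistory E H) (he : e ∈ E) (ha : assigned H e.2 = false)
      (hmin : ∀ i, (i, e.2) ∈ E → price H e.1 ≤ price H i) : IsHistory E (e :: H)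

theorem IsHistory.subset {E H : List (ι × σ)} (h : IsHistory E H) : H ⊆ E := by
  induction h with
  | nil => simp
  | cons _ he _ _ ih => exact List.cons_subset.2 ⟨he, ih⟩

/-- Only a bidder who owns nothing may bid, so nobody ever owns two items. -/
theorem IsHistory.owns_injective {E H : List (ι × σ)} (h : IsHistory E H) :
    ∀ {i j : ι} {s : σ}, owns H i s = true → owns H j s = true → i = j := by
  induction h with
  | nil => intro i j s h; simp [owns] at h
  | @cons e H _ _ ha _ ih =>
    intro i j s hi hj
    by_cases h1 : e.1 = i <;> by_cases h2 : e.1 = j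
    · rw [← h1, ← h2]
    · subst h1
      rw [owns_cons_self, decide_eq_true_eq] at hi
      rw [owns_cons_of_ne _ _ _ _ h2, ← hi] at hj
      rw [assigned_iff.2 ⟨j, hj⟩] at ha
      simp at ha
    · subst h2
      rw [owns_cons_self, decide_eq_true_eq] at hj
      rw [owns_cons_of_ne _ _ _ _ h1, ← hj] at hi
      rw [assigned_iff.2 ⟨i, hi⟩] at ha
      simp at ha
    · rw [owns_cons_of_ne _ _ _ _ h1] at hi
      rw [owns_cons_of_ne _ _ _ _ h2] at hj
      exact ih hi hj

/-- The owned item was a cheapest one for its owner before her bid raised its price by one. While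
she owns it its price stays fixed, and other prices never fall. -/
theorem IsHistory.price_le {E H : List (ι × σ)} (h : IsHistory E H) :
    ∀ {i j : ι} {s : σ}, owns H i s = true → (j, s) ∈ E → price H i ≤ price H j + 1 := by
  induction h with
  | nil => intro i j s h; simp [owns] at h
  | @cons e H _ _ ha hmin ih =>
    intro i j s hi hj
    rw [price_cons, price_cons]
    by_cases h1 : e.1 = i
    · subst h1
      rw [owns_cons_self, decide_eq_true_eq] at hi
      subst hi
      have := hmin j hj
      simp only [if_true]
      omega
    · rw [owns_cons_of_ne _ _ _ _ h1] at hi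
      have := ih hi hj
      simp only [h1, if_false]
      omega

/-- If the price of every item of an unassigned bidder is at least the number of edges, then no
injective assignment exists: below that number some price `j` does not occur, and the owners of the
items that cost more than `j`, together with this bidder, violate Hall's condition. -/
theorem IsHistory.not_injOn {E H : List (ι × σ)} (h : IsHistory E H) {i₀ : ι} {s₀ : σ}
    (he : (i₀, s₀) ∈ E) (ha : assigned H s₀ = false)
    (hp : ∀ i, (i, s₀) ∈ E → E.length ≤ price H i) {L : List σ} (hL : ∀ e ∈ E, e.2 ∈ L)
    (g : σ → ι) (hg : ∀ s ∈ L, (g s, s) ∈ E) (hinj : Set.InjOn g {s | s ∈ L}) : False := by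
  classical
  have : Nonempty ι := ⟨i₀⟩
  have : Nonempty σ := ⟨s₀⟩
  set I : Finset ι := (E.map Prod.fst).toFinset with hI
  have hIcard : I.card ≤ E.length := by
    simpa using (E.map Prod.fst).toFinset_card_le
  have hEI : ∀ e ∈ E, e.1 ∈ I := fun e he => by
    simp only [hI, List.mem_toFinset, List.mem_map]
    exact ⟨e, he, rfl⟩
  -- Otherwise the prices below `E.length` would be attained by as many distinct items, all
  -- different from `i₀`, whose price is higher; but there are at most `E.length` items including
  -- `i₀`.
  obtain ⟨j, hj, hlev⟩ : ∃ j < E.length, ∀ i ∈ I, price H i ≠ j := by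
    by_contra hcon
    push Not at hcon
    choose! f hfI hf using hcon
    have hsub : (Finset.range E.length).image f ⊆ I.erase i₀ := by
      intro i hi
      obtain ⟨j, hj, rfl⟩ := Finset.mem_image.1 hi
      rw [Finset.mem_range] at hj
      refine Finset.mem_erase.2 ⟨fun h0 => ?_, hfI j hj⟩
      have h1 := hp i₀ he
      have h2 := hf j hj
      rw [h0] at h2
      omega
    have h1 := Finset.card_le_card hsub
    rw [Finset.card_image_of_injOn, Finset.card_range, Finset.card_erase_of_mem (hEI _ he)] at h1
    · have := Finset.card_pos.2 ⟨i₀, hEI _ he⟩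
      omega
    · intro a ha b hb hab
      rw [Finset.coe_range, Set.mem_Iio] at ha hb
      rw [← hf a ha, ← hf b hb, hab]
  set X : Finset ι := I.filter fun i => j < price H i with hX
  have hown : ∀ i ∈ X, ∃ s, owns H i s = true := fun i hi =>
    exists_owner (by have := (Finset.mem_filter.1 hi).2; omega)
  choose! o ho using hown
  have hs₀ : s₀ ∉ X.image o := by
    intro hs
    obtain ⟨i, hi, rfl⟩ := Finset.mem_image.1 hs
    rw [assigned_iff.2 ⟨i, ho i hi⟩] at ha
    simp at ha
  have hoinj : Set.InjOn o X := fun a ha b hb hab => by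
    have h1 := ho a ha
    have h2 := ho b hb
    rw [← hab] at h2
    exact h.owns_injective h1 h2
  -- The bidder `s₀` and the owners of items in `X` have edges only into `X`. An owner's items cost
  -- at least `j`, being at most one cheaper than what she owns, and no item costs exactly `j`.
  -- Hence `g` would inject one bidder more than `X` has items.
  have hmaps : ∀ s ∈ insert s₀ (X.image o), s ∈ L ∧ g s ∈ X := by
    intro s hs
    rcases Finset.mem_insert.1 hs with rfl | hs
    · have h1 := hL _ he
      have h2 := hg s h1
      have h3 := hp _ h2
      exact ⟨h1, Finset.mem_filter.2 ⟨hEI _ h2, by omega⟩⟩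
    · obtain ⟨i, hi, rfl⟩ := Finset.mem_image.1 hs
      have h1 := hL _ (h.subset (mem_of_owns (ho i hi)))
      have h2 := hg _ h1
      have h3 : price H i ≤ price H (g (o i)) + 1 := h.price_le (ho i hi) h2
      have h4 := (Finset.mem_filter.1 hi).2
      have h5 := hlev _ (hEI _ h2)
      simp only at h5
      exact ⟨h1, Finset.mem_filter.2 ⟨hEI _ h2, by omega⟩⟩
  have hcard := Finset.card_le_card_of_injOn g (fun s hs => (hmaps s hs).2)
    (hinj.mono fun s hs => (hmaps s hs).1)
  rw [Finset.card_insert_of_notMem hs₀, Finset.card_image_of_injOn hoinj] at hcard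
  omega

theorem isHistory_bidStep {E H : List (ι × σ)} (h : IsHistory E H) : IsHistory E (bidStep E H) := by
  unfold bidStep
  rcases nextBid_spec E H with ⟨h1, _⟩ | ⟨e, h1, h2, h3, h4⟩
  · rwa [h1]
  · rw [h1]
    exact .cons h h2 h3 fun i hi => h4 _ hi h3

theorem isHistory_iterate (E : List (ι × σ)) (n : ℕ) : IsHistory E ((bidStep E)^[n] []) := by
  induction n with
  | zero => exact .nil
  | succ n ih => rw [Function.iterate_succ_apply']; exact isHistory_bidStep ih

/-- In a history with a price above the number of edges, somebody has bid at such a price. -/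
theorem IsHistory.exists_high_bid {E H : List (ι × σ)} (h : IsHistory E H) {i : ι} {N : ℕ}
    (hi : N < price H i) : ∃ H' e, IsHistory E H' ∧ e ∈ E ∧ assigned H' e.2 = false ∧
      ∀ i, (i, e.2) ∈ E → N ≤ price H' i := by
  induction h with
  | nil => simp [price] at hi
  | @cons e H hH he ha hmin ih =>
    by_cases h1 : N < price H i
    · exact ih h1
    · rw [price_cons] at hi
      by_cases h2 : e.1 = i
      · subst h2
        simp only [if_true] at hi
        exact ⟨H, e, hH, he, ha, fun j hj => le_trans (by omega) (hmin j hj)⟩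
      · simp only [h2, if_false] at hi
        omega

/-- The auction gains a bid in every round until no bidder with an edge is unassigned. -/
theorem length_iterate (E : List (ι × σ)) (n : ℕ) :
    ((bidStep E)^[n] []).length = n ∨ ∀ e ∈ E, assigned ((bidStep E)^[n] []) e.2 = true := by
  induction n with
  | zero => left; rfl
  | succ n ih =>
    rw [Function.iterate_succ_apply']
    unfold bidStep at ih ⊢
    rcases nextBid_spec E ((fun H => nextBid E H ++ H)^[n] []) with ⟨h1, h2⟩ | ⟨e, h1, h2, h3, _⟩
    · right
      rw [h1]
      exact h2
    · rcases ih with ih | ih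
      · left
        rw [h1]
        simp [ih]
      · have := ih e h2
        rw [h3] at this
        simp at this

/-- If everybody is assigned, ownership is the injective assignment. If the auction is still gaining
a bid in every round, the prices of at most `E.length` items sum to more than the square of
`E.length`. Some price then exceeds `E.length`, and the bid that raised it that far contradicts the
existence of `g` by `IsHistory.not_injOn`. -/
theorem matchable_iff [Nonempty ι] {L : List σ} {E : List (ι × σ)} (hL : ∀ e ∈ E, e.2 ∈ L) :
    matchable L E = true ↔
      ∃ g : σ → ι, (∀ s ∈ L, (g s, s) ∈ E) ∧ Set.InjOn g {s | s ∈ L} := by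
  classical
  have hH := isHistory_iterate E (E.length * E.length + 1)
  unfold matchable
  set H := (bidStep E)^[E.length * E.length + 1] [] with hHdef
  rw [List.all_eq_true]
  constructor
  · intro hall
    have : ∀ s ∈ L, ∃ i, owns H i s = true := fun s hs => assigned_iff.1 (hall s hs)
    choose! g hg using this
    refine ⟨g, fun s hs => hH.subset (mem_of_owns (hg s hs)), fun s hs s' hs' heq => ?_⟩
    have h1 := hg s hs
    have h2 := hg s' hs'
    rw [← heq] at h2
    exact owner_unique h1 h2
  · rintro ⟨g, hg, hinj⟩ s hs
    rcases length_iterate E (E.length * E.length + 1) with hlen | hall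
    · exfalso
      rw [← hHdef] at hlen
      set I : Finset ι := (E.map Prod.fst).toFinset with hI
      have hIcard : I.card ≤ E.length := by
        simpa using (E.map Prod.fst).toFinset_card_le
      have hsum := sum_price (H := H) (I := I) fun e he => by
        simp only [hI, List.mem_toFinset, List.mem_map]
        exact ⟨e, hH.subset he, rfl⟩
      obtain ⟨i, hi⟩ : ∃ i, E.length < price H i := by
        by_contra hcon
        push Not at hcon
        have h1 : ∑ i ∈ I, price H i ≤ I.card * E.length := by
          simpa using Finset.sum_le_card_nsmul I _ _ fun i _ => hcon i
        have h2 := Nat.mul_le_mul_right E.length hIcard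
        omega
      obtain ⟨H', e, h1, h2, h3, h4⟩ := hH.exists_high_bid hi
      exact h1.not_injOn h2 h3 h4 hL g hg hinj
    · exact hall _ (hg s hs)

end auction

/-! ### Balanced policies -/

section policies

variable {n m : ℕ} {P : Profile n m}

theorem favourite_eq_none {a : Fin n} {S : Finset (Fin m)} (h : favourite P a S = none) :
    S = ∅ := by
  rw [favourite, List.find?_eq_none] at h
  refine Finset.eq_empty_of_forall_notMem fun o ho => ?_
  have := h o (List.mem_map.2 ⟨(P a).symm o, List.mem_finRange _, by simp⟩)
  simp [ho] at this

theorem favourite_eq_some {a : Fin n} {S : Finset (Fin m)} {o : Fin m}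
    (h : favourite P a S = some o) :
    o ∈ S ∧ ∀ t ∈ S, (P a).symm o ≤ (P a).symm t := by
  rw [favourite, List.find?_eq_some_iff_append] at h
  obtain ⟨h1, u, v, huv, hu⟩ := h
  have hoS : o ∈ S := by simpa using h1
  refine ⟨hoS, fun t ht => ?_⟩
  have hmem : t ∈ (List.finRange m).map (P a) :=
    List.mem_map.2 ⟨(P a).symm t, List.mem_finRange _, by simp⟩
  rw [huv, List.mem_append, List.mem_cons] at hmem
  rcases hmem with hmem | rfl | hmem
  · have := hu t hmem
    simp [ht] at this
  · exact le_rfl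
  · have hs : (List.finRange m).Pairwise (· < ·) := List.pairwise_lt_finRange m
    have hs' : ((List.finRange m).map (P a)).Pairwise
        fun x y => (P a).symm x < (P a).symm y := by
      rw [List.pairwise_map]
      simpa using hs
    rw [huv, List.pairwise_append, List.pairwise_cons] at hs'
    exact (hs'.2.1.1 t hmem).le

theorem favourite_of_mem {a : Fin n} {S : Finset (Fin m)} {o : Fin m} (ho : o ∈ S)
    (hmin : ∀ t ∈ S, (P a).symm o ≤ (P a).symm t) : favourite P a S = some o := by
  rcases h : favourite P a S with _ | o'
  · rw [favourite_eq_none h] at ho; simp at ho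
  · obtain ⟨h1, h2⟩ := favourite_eq_some h
    rw [(P a).symm.injective (le_antisymm (h2 o ho) (hmin o' h1))]

theorem exists_favourite {a : Fin n} {S : Finset (Fin m)} (h : S.Nonempty) :
    ∃ o, favourite P a S = some o := by
  rcases ho : favourite P a S with _ | o
  · rw [favourite_eq_none ho] at h; simp at h
  · exact ⟨o, rfl⟩

theorem picks_cons {a : Fin n} {π : List (Fin n)} {S : Finset (Fin m)} {o : Fin m}
    (h : favourite P a S = some o) : picks P (a :: π) S = (a, o) :: picks P π (S.erase o) := by
  simp only [picks, h]

theorem picks_empty (π : List (Fin n)) : picks P π ∅ = [] := by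
  cases π with
  | nil => rfl
  | cons a π =>
    have : favourite P a ∅ = none := by simp [favourite]
    simp only [picks, this]

/-- The items that are left when the turns of `π` have been taken. -/
def left (P : Profile n m) (π : List (Fin n)) (S : Finset (Fin m)) : Finset (Fin m) :=
  S \ ((picks P π S).map Prod.snd).toFinset

theorem left_cons {a : Fin n} {π : List (Fin n)} {S : Finset (Fin m)} {o : Fin m}
    (h : favourite P a S = some o) : left P (a :: π) S = left P π (S.erase o) := by
  rw [left, left, picks_cons h]
  ext x
  simp
  tauto

theorem picks_append (π ρ : List (Fin n)) (S : Finset (Fin m)) :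
    picks P (π ++ ρ) S = picks P π S ++ picks P ρ (left P π S) := by
  induction π generalizing S with
  | nil => simp [picks, left]
  | cons a π ih =>
    rcases S.eq_empty_or_nonempty with rfl | hS
    · simp [left, picks_empty]
    · obtain ⟨o, ho⟩ := exists_favourite (P := P) (a := a) hS
      rw [List.cons_append, picks_cons ho, picks_cons ho, left_cons ho, ih, List.cons_append]

theorem left_append (π ρ : List (Fin n)) (S : Finset (Fin m)) :
    left P (π ++ ρ) S = left P ρ (left P π S) := by
  ext x
  simp only [left, picks_append]
  simp
  tauto

/-- An item left at the end was available at every pick, so whoever picked `o` then preferred it. -/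
theorem mem_of_mem_picks {π : List (Fin n)} {S : Finset (Fin m)} {c : Fin n} {o : Fin m}
    (h : (c, o) ∈ picks P π S) : c ∈ π ∧ o ∈ S ∧
      ∀ t ∈ left P π S, (P c).symm o < (P c).symm t := by
  induction π generalizing S with
  | nil => simp [picks] at h
  | cons a π ih =>
    rcases S.eq_empty_or_nonempty with rfl | hS
    · simp [picks_empty] at h
    · obtain ⟨f, hf⟩ := exists_favourite (P := P) (a := a) hS
      rw [left_cons hf]
      rw [picks_cons hf, List.mem_cons] at h
      obtain ⟨h1, h2⟩ := favourite_eq_some hf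
      rcases h with h | h
      · obtain ⟨rfl, rfl⟩ := Prod.ext_iff.1 h
        refine ⟨List.mem_cons_self, h1, fun t ht => ?_⟩
        have ht' := Finset.mem_erase.1 (Finset.mem_sdiff.1 ht).1
        exact lt_of_le_of_ne (h2 t ht'.2) fun he => ht'.1 ((P _).symm.injective he).symm
      · obtain ⟨h3, h4, h5⟩ := ih h
        exact ⟨List.mem_cons_of_mem _ h3, Finset.mem_of_mem_erase h4, h5⟩

theorem nodup_picks (π : List (Fin n)) (S : Finset (Fin m)) :
    ((picks P π S).map Prod.snd).Nodup := by
  induction π generalizing S with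
  | nil => simp [picks]
  | cons a π ih =>
    rcases S.eq_empty_or_nonempty with rfl | hS
    · simp [picks_empty]
    · obtain ⟨f, hf⟩ := exists_favourite (P := P) (a := a) hS
      rw [picks_cons hf, List.map_cons, List.nodup_cons]
      refine ⟨fun h => ?_, ih _⟩
      obtain ⟨⟨c, o⟩, h1, h2⟩ := List.mem_map.1 h
      have := (mem_of_mem_picks h1).2.1
      simp only at h2
      rw [h2] at this
      simp at this

theorem map_fst_picks {π : List (Fin n)} {S : Finset (Fin m)} (h : π.length ≤ S.card) :
    (picks P π S).map Prod.fst = π := by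
  induction π generalizing S with
  | nil => simp [picks]
  | cons a π ih =>
    rw [List.length_cons] at h
    have hS : S.Nonempty := Finset.card_pos.1 (by omega)
    obtain ⟨f, hf⟩ := exists_favourite (P := P) (a := a) hS
    rw [picks_cons hf, List.map_cons, ih]
    rw [Finset.card_erase_of_mem (favourite_eq_some hf).1]
    omega

theorem card_left {π : List (Fin n)} {S : Finset (Fin m)} (h : π.length ≤ S.card) :
    (left P π S).card = S.card - π.length := by
  rw [left, Finset.card_sdiff_of_subset, List.toFinset_card_of_nodup (nodup_picks _ _),
    List.length_map]
  · conv_rhs => rw [← map_fst_picks (P := P) h]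
    rw [List.length_map]
  · intro o ho
    rw [List.mem_toFinset] at ho
    obtain ⟨⟨c, o'⟩, h1, rfl⟩ := List.mem_map.1 ho
    exact (mem_of_mem_picks h1).2.1

theorem mem_bundle {π : List (Fin n)} {a : Fin n} {o : Fin m} :
    o ∈ bundle P π a ↔ (a, o) ∈ picks P π Finset.univ := by
  simp [bundle]

theorem card_bundle {π : List (Fin n)} (h : π.length ≤ m) (a : Fin n) :
    (bundle P π a).card = π.count a := by
  have e : bundle P π a =
      (((picks P π Finset.univ).filter fun x => decide (x.1 = a)).map Prod.snd).toFinset := by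
    ext o
    rw [mem_bundle]
    simp
  rw [e, List.toFinset_card_of_nodup, List.length_map]
  · conv_rhs => rw [← map_fst_picks (P := P) (π := π) (S := Finset.univ) (by simpa using h)]
    rw [List.count_eq_countP, List.countP_map, List.countP_eq_length_filter]
    rfl
  · exact (nodup_picks _ _).sublist (List.filter_sublist.map _)

theorem mem_topItems {a : Fin n} {k : ℕ} {o : Fin m} :
    o ∈ topItems P a k ↔ ((P a).symm o : ℕ) < k := by
  simp [topItems]

theorem card_topItems {a : Fin n} {k : ℕ} (h : k ≤ m) : (topItems P a k).card = k := by
  have : (topItems P a k).card = (Finset.univ.filter fun r : Fin m => (r : ℕ) < k).card := by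
    refine Finset.card_bij (fun o _ => (P a).symm o) ?_ ?_ ?_
    · intro o ho; simpa [topItems] using ho
    · intro o _ o' _ h; exact (P a).symm.injective h
    · intro r hr; exact ⟨P a r, by simpa [topItems] using hr, by simp⟩
  rw [this, Fin.card_filter_val_lt]
  omega

/-- If the others, among themselves, never pick an item of the top set of `a`, then `a` only gets
items of her top set. -/
theorem mem_topItems_of_mem_picks {a : Fin n} {k : ℕ} :
    ∀ {π : List (Fin n)} {S S' : Finset (Fin m)},
    S ⊆ S' → S' \ S ⊆ topItems P a k → π.count a ≤ (topItems P a k ∩ S).card →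
    (∀ c o, (c, o) ∈ picks P (π.filter fun c => decide (c ≠ a)) S' → o ∉ topItems P a k) →
    ∀ o, (a, o) ∈ picks P π S → o ∈ topItems P a k := by
  -- `S` is the stock of the actual run and `S'` that of the others playing alone. The invariant
  -- says that the stocks differ only by top items of `a`, and that enough top items remain for the
  -- turns of `a` still to come.
  intro π
  induction π with
  | nil => intro S S' _ _ _ _ o ho; simp [picks] at ho
  | cons c π ih =>
    intro S S' hSS' hdiff hcount hsafe o ho
    rcases S.eq_empty_or_nonempty with rfl | hS
    · simp [picks_empty] at ho
    obtain ⟨f, hf⟩ := exists_favourite (P := P) (a := c) hS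
    obtain ⟨hfS, hfmin⟩ := favourite_eq_some hf
    rw [picks_cons hf, List.mem_cons] at ho
    by_cases hca : c = a
    · subst hca
      rw [List.count_cons_self] at hcount
      obtain ⟨t, ht⟩ := Finset.card_pos.1 (lt_of_lt_of_le (Nat.succ_pos _) hcount)
      obtain ⟨ht1, ht2⟩ := Finset.mem_inter.1 ht
      have hfT : f ∈ topItems P c k := by
        rw [mem_topItems] at ht1 ⊢
        exact lt_of_le_of_lt (hfmin t ht2) ht1
      rcases ho with ho | ho
      · obtain ⟨_, rfl⟩ := Prod.ext_iff.1 ho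
        exact hfT
      · refine ih (S := S.erase f) (S' := S') ((Finset.erase_subset _ _).trans hSS') ?_ ?_ ?_ o ho
        · intro x hx
          obtain ⟨h1, h2⟩ := Finset.mem_sdiff.1 hx
          by_cases hxf : x = f
          · rwa [hxf]
          · exact hdiff (Finset.mem_sdiff.2 ⟨h1, fun h => h2 (Finset.mem_erase.2 ⟨hxf, h⟩)⟩)
        · rw [Finset.inter_erase, Finset.card_erase_of_mem (Finset.mem_inter.2 ⟨hfT, hfS⟩)]
          omega
        · intro d x hx
          refine hsafe d x ?_
          simpa using hx
    · have hfilt : (c :: π).filter (fun c => decide (c ≠ a)) =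
          c :: π.filter (fun c => decide (c ≠ a)) := by simp [hca]
      rw [hfilt] at hsafe
      obtain ⟨f', hf'⟩ := exists_favourite (P := P) (a := c) (hS.mono hSS')
      rw [picks_cons hf'] at hsafe
      have hf'T := hsafe c f' List.mem_cons_self
      obtain ⟨h1, h2⟩ := favourite_eq_some hf'
      -- The choice from the larger stock is no top item, hence also available in `S`; so the agent
      -- picks the same item in both runs.
      have hf'S : f' ∈ S := by
        by_contra h
        exact hf'T (hdiff (Finset.mem_sdiff.2 ⟨h1, h⟩))
      have hff' : f = f' := by
        have := favourite_of_mem hf'S fun t ht => h2 t (hSS' ht)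
        rw [hf] at this
        exact Option.some.inj this
      subst hff'
      rcases ho with ho | ho
      · exact absurd (congrArg Prod.fst ho).symm hca
      · refine ih (S := S.erase f) (S' := S'.erase f) (Finset.erase_subset_erase _ hSS') ?_ ?_ ?_
          o ho
        · intro x hx
          obtain ⟨h1, h2⟩ := Finset.mem_sdiff.1 hx
          obtain ⟨h3, h4⟩ := Finset.mem_erase.1 h1
          exact hdiff (Finset.mem_sdiff.2 ⟨h4, fun h => h2 (Finset.mem_erase.2 ⟨h3, h⟩)⟩)
        · rw [List.count_cons_of_ne hca] at hcount
          rwa [Finset.inter_erase, Finset.erase_eq_of_notMem]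
          exact fun h => hf'T (Finset.mem_inter.1 h).1
        · intro d x hx
          exact hsafe d x (List.mem_cons_of_mem _ hx)

/-- An assignment of items that are better than `y` can be turned into a policy that leaves `y`. -/
theorem exists_policy_of_injOn {σ : Type} [DecidableEq σ] (ag : σ → Fin n) (y : Fin m) (N : ℕ) :
    ∀ (R : Finset σ) (g : σ → Fin m) (S : Finset (Fin m)), R.card = N → Set.InjOn g R →
      (∀ s ∈ R, g s ∈ S ∧ (P (ag s)).symm (g s) < (P (ag s)).symm y) → y ∈ S →
      ∃ π : List (Fin n), (∀ c, π.count c = (R.filter fun s => ag s = c).card) ∧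
        y ∈ left P π S := by
  induction N with
  | zero =>
    intro R g S hR _ _ hy
    rw [Finset.card_eq_zero] at hR
    subst hR
    exact ⟨[], fun c => by simp, by simpa [left, picks] using hy⟩
  | succ N ih =>
    intro R g S hR hinj hg hy
    have hfav : ∀ c, ∃ o, favourite P c S = some o := fun c => exists_favourite ⟨y, hy⟩
    choose f hf using hfav
    have hR0 : R.Nonempty := Finset.card_pos.1 (by omega)
    -- The slot `s` may move first, taking its agent's favourite, as soon as the other slots have an
    -- assignment avoiding that item. It does not take `y`, because the favourite is at least as
    -- good as `g s`, which beats `y`.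
    have hstep : ∀ (g' : σ → Fin m) (s : σ), s ∈ R → Set.InjOn g' (R.erase s) →
        (∀ t ∈ R.erase s, g' t ∈ S ∧ (P (ag t)).symm (g' t) < (P (ag t)).symm y ∧
          g' t ≠ f (ag s)) →
        ∃ π : List (Fin n), (∀ c, π.count c = (R.filter fun s => ag s = c).card) ∧
          y ∈ left P π S := by
      intro g' s hs hinj' hg'
      have hfs := (favourite_eq_some (hf (ag s))).2 (g s) (hg s hs).1
      obtain ⟨π, h1, h2⟩ := ih (R.erase s) g' (S.erase (f (ag s)))
        (by rw [Finset.card_erase_of_mem hs]; omega) hinj'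
        (fun t ht => ⟨Finset.mem_erase.2 ⟨(hg' t ht).2.2, (hg' t ht).1⟩, (hg' t ht).2.1⟩)
        (Finset.mem_erase.2 ⟨fun h => by
          have := (hg s hs).2
          rw [h] at this
          exact absurd (lt_of_le_of_lt hfs this) (lt_irrefl _), hy⟩)
      refine ⟨ag s :: π, fun c => ?_, by rwa [left_cons (hf _)]⟩
      rw [List.count_cons, h1, Finset.filter_erase]
      by_cases hc : ag s = c
      · have hmem : s ∈ R.filter fun s => ag s = c := Finset.mem_filter.2 ⟨hs, hc⟩
        have := Finset.card_pos.2 ⟨s, hmem⟩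
        rw [Finset.card_erase_of_mem hmem]
        simp [hc]
        omega
      · rw [Finset.erase_eq_of_notMem (by simp [hc])]
        simp [hc]
    -- If the favourite of some slot is assigned to no slot, that slot moves first and the
    -- assignment of the others is kept.
    by_cases hex : ∃ s ∈ R, ∀ t ∈ R, g t ≠ f (ag s)
    · obtain ⟨s, hs, hsf⟩ := hex
      exact hstep g s hs (hinj.mono (Finset.coe_subset.2 (Finset.erase_subset _ _))) fun t ht =>
        ⟨(hg t (Finset.mem_of_mem_erase ht)).1, (hg t (Finset.mem_of_mem_erase ht)).2,
          hsf t (Finset.mem_of_mem_erase ht)⟩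
    · push Not at hex
      choose φ hφR hφ using hex
      -- Every favourite is held by some slot, so each slot points to the holder of its favourite.
      -- Finiteness yields a cycle, as in top trading cycles.
      let ψ : R → R := fun s => ⟨φ s.1 s.2, hφR s.1 s.2⟩
      have hψ : ∀ s : R, g (ψ s) = f (ag s) := fun s => hφ s.1 s.2
      have : Nonempty R := hR0.to_subtype
      obtain ⟨s₀, hs₀⟩ : ∃ s, s ∈ Function.periodicPts ψ := by
        obtain ⟨i, j, hij, h⟩ := Finite.exists_ne_map_eq_of_infinite
          fun i : ℕ => ψ^[i] (Classical.arbitrary R)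
        wlog hlt : i < j generalizing i j
        · exact this j i hij.symm h.symm (by omega)
        refine ⟨ψ^[i] (Classical.arbitrary R), Function.mk_mem_periodicPts (n := j - i)
          (by omega) ?_⟩
        rw [Function.IsPeriodicPt, Function.IsFixedPt, ← Function.iterate_add_apply,
          Nat.sub_add_cancel hlt.le, h]
      have hbij := Function.bijOn_periodicPts ψ
      classical
      -- Trading along all cycles gives each slot on a cycle its favourite and changes nothing
      -- elsewhere. It keeps the assignment injective, since `ψ` permutes its periodic points.
      let ψ' : R → R := fun s => if s ∈ Function.periodicPts ψ then ψ s else s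
      have hψ'inj : Function.Injective ψ' := by
        intro s t hst
        by_cases hs : s ∈ Function.periodicPts ψ <;> by_cases ht : t ∈ Function.periodicPts ψ
        · simp only [ψ', hs, ht, if_true] at hst
          exact hbij.injOn hs ht hst
        · simp only [ψ', hs, ht, if_true, if_false] at hst
          exact absurd (hst ▸ hbij.mapsTo hs) ht
        · simp only [ψ', hs, ht, if_true, if_false] at hst
          exact absurd (hst ▸ hbij.mapsTo ht) hs
        · simpa only [ψ', hs, ht, if_false] using hst
      let g' : σ → Fin m := fun s => if h : s ∈ R then g (ψ' ⟨s, h⟩) else y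
      have hg' : ∀ s (h : s ∈ R), g' s = g (ψ' ⟨s, h⟩) := fun s h => dif_pos h
      have hinj' : Set.InjOn g' R := by
        intro s hs t ht hst
        rw [Finset.mem_coe] at hs ht
        rw [hg' s hs, hg' t ht] at hst
        have := hinj (ψ' ⟨s, hs⟩).2 (ψ' ⟨t, ht⟩).2 hst
        exact congrArg Subtype.val (hψ'inj (Subtype.ext this))
      have hval : ∀ s (h : s ∈ R), g' s = f (ag s) ∨ g' s = g s := by
        intro s h
        rw [hg' s h]
        by_cases hp : (⟨s, h⟩ : R) ∈ Function.periodicPts ψ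
        · left; simp only [ψ', hp, if_true]; exact hψ ⟨s, h⟩
        · right; simp only [ψ', hp, if_false]
      have hs₀' : g' s₀ = f (ag s₀) := by
        rw [hg' _ s₀.2]
        simp only [ψ', Subtype.coe_eta, hs₀, if_true]
        exact hψ s₀
      -- After the trade `s₀` itself holds its favourite, so by injectivity no other slot does and
      -- `s₀` can move first.
      refine hstep g' s₀ s₀.2 (hinj'.mono (Finset.coe_subset.2 (Finset.erase_subset _ _)))
        fun t ht => ?_
      obtain ⟨ht1, ht2⟩ := Finset.mem_erase.1 ht
      refine ⟨?_, ?_, fun h => ht1 (hinj' ht2 s₀.2 (h.trans hs₀'.symm))⟩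
      · rcases hval t ht2 with h | h
        · rw [h]; exact (favourite_eq_some (hf _)).1
        · rw [h]; exact (hg t ht2).1
      · rcases hval t ht2 with h | h
        · rw [h]
          exact lt_of_le_of_lt ((favourite_eq_some (hf _)).2 _ (hg t ht2).1) (hg t ht2).2
        · rw [h]; exact (hg t ht2).2

end policies

/-! ### When an agent can miss her top items: reduction to matchings. -/

section characterisation

variable {n k : ℕ} {P : Profile n (n * k)}

theorem length_eq_sum_count (π : List (Fin n)) : π.length = ∑ c, π.count c := by
  induction π with
  | nil => simp
  | cons a π ih => simp [List.count_cons, Finset.sum_add_distrib, ih]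

theorem mem_balancedPolicies {π : List (Fin n)} (h : ∀ c, π.count c = k) :
    π ∈ balancedPolicies n (n * k) := by
  refine ⟨?_, fun a b => by rw [h, h]⟩
  rw [length_eq_sum_count]
  simp [h]

theorem count_of_mem_balancedPolicies {π : List (Fin n)} (h : π ∈ balancedPolicies n (n * k))
    (c : Fin n) : π.count c = k := by
  have h1 := length_eq_sum_count π
  rw [h.1, Finset.sum_congr rfl fun d _ => h.2 d c] at h1
  simp only [Finset.sum_const, Finset.card_univ, Fintype.card_fin, smul_eq_mul] at h1
  have hn : 0 < n := c.pos
  exact (Nat.eq_of_mul_eq_mul_left hn h1).symm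

theorem length_eq_count_add (a : Fin n) (π : List (Fin n)) :
    π.length = π.count a + (π.filter fun c => decide (c ≠ a)).length := by
  induction π with
  | nil => rfl
  | cons c π ih =>
    by_cases h : c = a
    · simp [h, ih]; omega
    · rw [List.count_cons_of_ne h]
      simp [h, ih]; omega

/-- There is a balanced policy under which `a` gets her top items. -/
theorem exists_bundle_eq_topItems (P : Profile n (n * k)) (a : Fin n) :
    ∃ π ∈ balancedPolicies n (n * k), bundle P π a = topItems P a k := by
  have hkm : k ≤ n * k := Nat.le_mul_of_pos_left k a.pos
  set ρ : List (Fin n) := ((List.finRange n).filter fun c => decide (c ≠ a)).flatMap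
    (List.replicate k) with hρ
  have haρ : a ∉ ρ := by simp [hρ]
  have hcount : ∀ c, (List.replicate k a ++ ρ).count c = k := by
    intro c
    rw [List.count_append, List.count_replicate]
    by_cases hc : a = c
    · subst hc
      simp [List.count_eq_zero_of_not_mem haρ]
    · have : ∀ l : List (Fin n), l.Nodup → c ∈ l → (l.flatMap (List.replicate k)).count c = k := by
        intro l
        induction l with
        | nil => simp
        | cons d l ih =>
          intro hnd hcl
          rw [List.nodup_cons] at hnd
          rw [List.flatMap_cons, List.count_append, List.count_replicate]
          by_cases hdc : d = c
          · subst hdc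
            rw [List.count_eq_zero_of_not_mem]
            · simp
            · intro h
              obtain ⟨e, he, hde⟩ := List.mem_flatMap.1 h
              exact hnd.1 ((List.mem_replicate.1 hde).2 ▸ he)
          · rw [ih hnd.2 ((List.mem_cons.1 hcl).resolve_left (Ne.symm hdc))]
            simp [hdc]
      rw [hρ, this _ ((List.nodup_finRange n).filter _) (by simp [Ne.symm hc])]
      simp [hc]
  have hbal := mem_balancedPolicies hcount
  refine ⟨_, hbal, Finset.eq_of_subset_of_card_le (fun o ho => ?_) ?_⟩
  · rw [mem_bundle, picks_append, List.mem_append] at ho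
    rcases ho with ho | ho
    -- Only `a` moves in this block, so the condition on the picks of the others is vacuous.
    · refine mem_topItems_of_mem_picks (a := a) (S := Finset.univ) (S' := Finset.univ) subset_rfl
        (by simp) ?_ ?_ o ho
      · rw [Finset.inter_univ, card_topItems hkm]; simp
      · intro c x hx
        have : (List.replicate k a).filter (fun c => decide (c ≠ a)) = [] := by simp
        rw [this] at hx
        simp [picks] at hx
    · exact absurd (mem_of_mem_picks ho).1 haρ
  · rw [card_topItems hkm, card_bundle hbal.1.le, hcount]

/-- The agent `a` can fail to get her top items iff, for some other agent `b`, the remaining agents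
can be given `k` items each that they prefer to an item `y` outside the top set, where `b` prefers
some item of the top set to `y`. -/
theorem exists_bundle_ne_topItems_iff (a : Fin n) :
    (∃ π ∈ balancedPolicies n (n * k), bundle P π a ≠ topItems P a k) ↔
    ∃ b, b ≠ a ∧ ∃ y, y ∉ topItems P a k ∧
      (∃ t ∈ topItems P a k, (P b).symm t < (P b).symm y) ∧
      ∃ g : Fin n × Fin k → Fin (n * k),
        Set.InjOn g {s | s.1 ≠ a ∧ s.1 ≠ b} ∧
        ∀ s, s.1 ≠ a → s.1 ≠ b → (P s.1).symm (g s) < (P s.1).symm y := by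
  have hkm : k ≤ n * k := Nat.le_mul_of_pos_left k a.pos
  constructor
  · rintro ⟨π, hπ, hne⟩
    have hcount := count_of_mem_balancedPolicies hπ
    set ρ := π.filter fun c => decide (c ≠ a) with hρ
    have hlen : ρ.length = n * k - k := by
      have := length_eq_count_add a π
      rw [hπ.1, hcount, ← hρ] at this
      omega
    have hρm : ρ.length ≤ n * k := by omega
    -- If the others alone never touched the top set, `a` would get k items all from it, hence
    -- exactly that set.
    obtain ⟨b, t, hbt, ht⟩ : ∃ b t, (b, t) ∈ picks P ρ Finset.univ ∧ t ∈ topItems P a k := by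
      by_contra hcon
      push Not at hcon
      refine hne (Finset.eq_of_subset_of_card_le (fun o ho => ?_) ?_)
      · refine mem_topItems_of_mem_picks (a := a) (π := π) (S := Finset.univ) (S' := Finset.univ)
          subset_rfl (by simp) ?_ hcon o (mem_bundle.1 ho)
        rw [Finset.inter_univ, card_topItems hkm, hcount]
      · rw [card_topItems hkm, card_bundle hπ.1.le, hcount]
    have hcard : (left P ρ Finset.univ).card = k := by
      rw [card_left (by simpa using hρm), hlen, Finset.card_univ, Fintype.card_fin]
      omega
    have htl : t ∉ left P ρ Finset.univ := fun h => lt_irrefl _ ((mem_of_mem_picks hbt).2.2 t h)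
    -- As many items are left as there are top items, and the top item `t` is gone.
    obtain ⟨y, hy, hyT⟩ : ∃ y ∈ left P ρ Finset.univ, y ∉ topItems P a k := by
      by_contra hcon
      push Not at hcon
      have := Finset.eq_of_subset_of_card_le (fun y hy => hcon y hy)
        (by rw [hcard, card_topItems hkm])
      exact htl (this ▸ ht)
    refine ⟨b, ?_, y, hyT, ⟨t, ht, (mem_of_mem_picks hbt).2.2 y hy⟩, ?_⟩
    · have := (mem_of_mem_picks hbt).1
      simp [hρ] at this
      exact this.2
    · have hB : ∀ c, c ≠ a → (bundle P ρ c).card = k := fun c hc => by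
        rw [card_bundle hρm, hρ, List.count_filter (by simpa using hc), hcount]
      -- The slots of each agent other than `a` enumerate her bundle in the run without `a`. The
      -- value `y` at the slots of `a` plays no role.
      let g : Fin n × Fin k → Fin (n * k) := fun s =>
        if h : s.1 ≠ a then ((bundle P ρ s.1).equivFinOfCardEq (hB _ h)).symm s.2 else y
      have hg : ∀ s, (h : s.1 ≠ a) →
          g s = ((bundle P ρ s.1).equivFinOfCardEq (hB _ h)).symm s.2 := fun s h => dif_pos h
      have hmem : ∀ s, s.1 ≠ a → (s.1, g s) ∈ picks P ρ Finset.univ := fun s h => by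
        rw [← mem_bundle, hg s h]
        exact Subtype.coe_prop _
      refine ⟨g, ?_, fun s hs _ => (mem_of_mem_picks (hmem s hs)).2.2 y hy⟩
      rintro ⟨c, i⟩ ⟨hs, _⟩ ⟨d, j⟩ ⟨ht, _⟩ hst
      have h1 := hmem _ hs
      have h2 := hmem _ ht
      have h3 := List.inj_on_of_nodup_map (nodup_picks ρ Finset.univ) h1 h2 hst
      obtain rfl : c = d := congrArg Prod.fst h3
      rw [hg _ hs, hg _ ht] at hst
      have h4 := Equiv.injective _ (Subtype.ext hst)
      simp only at h4
      rw [h4]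
  · rintro ⟨b, hba, y, hyT, ⟨t, ht, hty⟩, g, hinj, hg⟩
    set R : Finset (Fin n × Fin k) := Finset.univ.filter fun s => s.1 ≠ a ∧ s.1 ≠ b with hR
    obtain ⟨π, hπ, hy⟩ := exists_policy_of_injOn (P := P) Prod.fst y R.card R g Finset.univ rfl
      (by simpa [hR] using hinj)
      (fun s hs => by
        simp only [hR, Finset.mem_filter] at hs
        exact ⟨Finset.mem_univ _, hg s hs.2.1 hs.2.2⟩) (Finset.mem_univ y)
    have hπ' : ∀ c, π.count c = if c ≠ a ∧ c ≠ b then k else 0 := by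
      intro c
      rw [hπ, hR, Finset.filter_filter]
      split
      · next hc =>
        have : (Finset.univ.filter fun s : Fin n × Fin k => (s.1 ≠ a ∧ s.1 ≠ b) ∧ s.1 = c) =
            Finset.univ.image fun j : Fin k => (c, j) := by
          ext ⟨d, j⟩
          simp
          constructor
          · rintro ⟨_, rfl⟩; rfl
          · rintro rfl; exact ⟨hc, rfl⟩
        rw [this, Finset.card_image_of_injective _ (Prod.mk_right_injective c), Finset.card_univ,
          Fintype.card_fin]
      · next hc =>
        rw [Finset.card_eq_zero, Finset.filter_eq_empty_iff]
        rintro s _ ⟨h1, rfl⟩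
        exact hc h1
    -- The agents other than `a` and `b` move first and leave `y`; then `b` takes all her turns, and
    -- `a` comes last.
    have hcount : ∀ c, ((π ++ List.replicate k b) ++ List.replicate k a).count c = k := by
      intro c
      rw [List.count_append, List.count_append, hπ', List.count_replicate, List.count_replicate]
      by_cases hca : c = a
      · subst hca; simp [hba]
      · by_cases hcb : c = b
        · subst hcb; simp [Ne.symm hca]
        · simp [hca, hcb, Ne.symm hca, Ne.symm hcb]
    have hbal := mem_balancedPolicies hcount
    refine ⟨_, hbal, fun heq => ?_⟩
    set ρ := π ++ List.replicate k b with hρ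
    have hlen : ρ.length = n * k - k := by
      have := hbal.1
      rw [List.length_append, List.length_replicate] at this
      omega
    have haρ : a ∉ ρ := by
      intro h
      rw [hρ, List.mem_append, List.mem_replicate] at h
      rcases h with h | h
      · have := List.count_pos_iff.2 h
        rw [hπ'] at this
        simp at this
      · exact hba h.2.symm
    have hT : topItems P a k ⊆ left P ρ Finset.univ := by
      intro o ho
      rw [← heq, mem_bundle, picks_append, List.mem_append] at ho
      rcases ho with ho | ho
      · exact absurd (mem_of_mem_picks ho).1 haρ
      · exact (mem_of_mem_picks ho).2.1
    -- Moving last, `a` can get her top items only if they are exactly what the others leave. Then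
    -- `y` was taken, necessarily by `b`, while `t` was still there.
    have hTeq : topItems P a k = left P ρ Finset.univ := by
      refine Finset.eq_of_subset_of_card_le hT ?_
      rw [card_topItems hkm, card_left (by rw [hlen]; simp), hlen, Finset.card_univ,
        Fintype.card_fin]
      omega
    rw [hTeq] at hyT ht
    rw [hρ, left_append] at hyT ht
    rw [left, Finset.mem_sdiff] at hyT
    have hyp :
        y ∈ ((picks P (List.replicate k b) (left P π Finset.univ)).map Prod.snd).toFinset := by
      by_contra h
      exact hyT ⟨hy, h⟩
    rw [List.mem_toFinset] at hyp
    obtain ⟨⟨c, y'⟩, h1, h2⟩ := List.mem_map.1 hyp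
    simp only at h2
    subst h2
    obtain ⟨h3, _, h4⟩ := mem_of_mem_picks h1
    obtain ⟨_, rfl⟩ := List.mem_replicate.1 h3
    exact lt_asymm hty (h4 t ht)

end characterisation

/-! ### Programs on bit strings -/

namespace Prog

/-- Turn the bit string on the stack `2`, which has its last bit on top, into a list tree. -/
def readLoop : Prog :=
  loop 2 Option.isSome (seq (ite 2 isTrue
    -- Read from the top, the pushed bits are the node bit of the list followed by the encoding of
    -- the element.
    (seq (push 0 false) (seq (push 0 false) (seq (push 0 true) (push 0 true))))
    (seq (push 0 false) (push 0 true))) (pop 2))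

theorem runs_readLoop (v : List Bool) : ∀ u : List Bool,
    Runs readLoop (stk (bits u) [] v []) (stk (bits (v.reverse ++ u)) [] [] [])
      (7 * v.length + 1) := by
  induction v with
  | nil => intro u; exact Runs.loop_done (by simp)
  | cons b v ih =>
    intro u
    have h2 := ih (b :: u)
    rw [List.reverse_cons, List.append_assoc, List.singleton_append]
    refine (Runs.loop_step (T := 6) (by simp) ?_ h2).mono
      (by simp only [List.length_cons]; omega)
    have hpop := Runs.pop 2 (stk (bits (b :: u)) [] (b :: v) [])
    simp only [update_stk_two, stk_two, List.tail_cons] at hpop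
    refine Runs.seq (T := 5) ?_ hpop
    cases b
    · refine (Runs.ite_false (T := 1 + 1) (by simp [isTrue]) ?_).mono (by omega)
      simpa [bits_cons, bits_false] using
        (Runs.push 0 false (stk (bits u) [] (false :: v) [])).seq (Runs.push 0 true _)
    · refine (Runs.ite_true (T := 1 + (1 + (1 + 1))) (by simp [isTrue]) ?_).mono (by omega)
      simpa [bits_cons, bits_true] using
        (Runs.push 0 false (stk (bits u) [] (true :: v) [])).seq
          ((Runs.push 0 false _).seq ((Runs.push 0 true _).seq (Runs.push 0 true _)))

/-- Turn the bit string on the stack `1` into a list tree on the stack `0`. -/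
def read : Prog := seq (pour 1 2) (seq (push 0 false) readLoop)

theorem runs_read (l : List Bool) :
    Runs read (stk [] l [] []) (stk (bits l) [] [] []) (11 * l.length + 3) := by
  have h1 := runs_pour (j := 1) (k := 2) (by decide) l (stk [] l [] []) rfl
  have h2 := Runs.push 0 false (stk [] [] l.reverse [])
  have h3 := runs_readLoop l.reverse []
  simp only [List.append_nil, List.reverse_reverse, update_stk_one, update_stk_two,
    update_stk_zero, stk_zero, stk_two, List.length_reverse] at h1 h2 h3
  exact (h1.seq (h2.seq h3)).mono (by omega)

/-- Replace a truth value on the stack `0` by a bit on the stack `1`. -/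
def write : Prog :=
  ite 0 isTrue (seq (pop 0) (seq (pop 0) (seq (pop 0) (push 1 true))))
    (seq (pop 0) (push 1 false))

theorem runs_write (b : Bool) :
    Runs write (stk (bits b) [] [] []) (stk [] [b] [] []) 5 := by
  cases b
  · refine (Runs.ite_false (T := 1 + 1) (by simp [isTrue, bits_false]) ?_).mono (by omega)
    simpa [bits_false] using
      (Runs.pop 0 (stk (bits false) [] [] [])).seq (Runs.push 1 false _)
  · refine (Runs.ite_true (T := 1 + (1 + (1 + 1))) (by simp [isTrue, bits_true]) ?_).mono
      (by omega)
    simpa [bits_true] using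
      (Runs.pop 0 (stk (bits true) [] [] [])).seq
        ((Runs.pop 0 _).seq ((Runs.pop 0 _).seq (Runs.push 1 true _)))

end Prog

theorem size_bools_le (l : List Bool) : size l ≤ 4 * l.length + 1 := by
  induction l with
  | nil => simp [size_nil]
  | cons b l ih =>
    have := size_bool_le b
    rw [size_cons, List.length_cons]
    omega

/-- A problem is in P if a polynomial-time function on bit strings decides it. -/
theorem inP_of_polyTime {Inst : Type} {enc : Inst → List Bool} {L : Inst → Prop}
    {d : List Bool → Bool} (hd : PolyTime d) (hL : ∀ x, d (enc x) = true ↔ L x) : InP enc L := by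
  obtain ⟨p, T, h⟩ := hd
  let q : Prog := .seq .read (.seq p .write)
  let T' : Polynomial ℕ := Polynomial.C 11 * Polynomial.X +
    T.comp (Polynomial.C 4 * Polynomial.X + 1) + Polynomial.C 9
  -- The machine's input and output are images under the identity map on symbols; `l₀` and `l₁`
  -- absorb these images.
  have key : ∀ l l₀ l₁ : List Bool, l₀ = l → l₁ = Computability.encodeBool (d l) →
      Nonempty (Turing.TM2OutputsInTime q.toTM l₀ (some l₁) (T'.eval l.length)) := by
    rintro _ l _ rfl rfl
    have h2 := h l []
    rw [List.append_nil, List.append_nil] at h2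
    obtain ⟨t, ht, he⟩ := (Prog.runs_read l).seq (h2.seq (Prog.runs_write (d l)))
    refine Prog.toTM_outputs q he ?_
    have := eval_mono T (size_bools_le l)
    simp only [T', Polynomial.eval_add, Polynomial.eval_mul, Polynomial.eval_C,
      Polynomial.eval_X, Polynomial.eval_comp, Polynomial.eval_one]
    omega
  exact ⟨fun x => d (enc x), hL, ⟨⟨⟨q.toTM, Equiv.refl Bool, Equiv.refl Bool⟩, T', fun x =>
    Classical.choice (key (enc x) _ _ (List.map_id _) (List.map_id _))⟩⟩⟩

/-! ### Matchings in polynomial time -/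

namespace PolyTime

variable {α β : Type} [Enc α] [Enc β]

theorem take_one {l : α → List β} (hl : PolyTime l) : PolyTime fun a => (l a).take 1 :=
  list_cases hl (const []) (cons (fst.comp snd) (const []))
    (fun a h => by rw [h]; rfl) fun a b t h => by rw [h]; rfl

section bids
variable {H E : α → List (ℕ × (ℕ × ℕ))} {i : α → ℕ} {s : α → ℕ × ℕ}

theorem decide_pair {s t : α → ℕ × ℕ} (hs : PolyTime s) (ht : PolyTime t) :
    PolyTime fun a => decide (s a = t a) :=
  eq_pair (eq (fst.comp hs) (fst.comp ht)) (eq (snd.comp hs) (snd.comp ht))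

theorem filter_item (hH : PolyTime H) (hi : PolyTime i) :
    PolyTime fun a => (H a).filter fun e => decide (e.1 = i a) := by
  have h : PolyTime fun x : α × (ℕ × (ℕ × ℕ)) => decide (x.2.1 = i x.1) :=
    eq (fst.comp snd) (hi.comp fst)
  exact filter (f := fun a (e : ℕ × (ℕ × ℕ)) => decide (e.1 = i a)) hH h

theorem price (hH : PolyTime H) (hi : PolyTime i) : PolyTime fun a => price (H a) (i a) :=
  length (filter_item hH hi)

theorem owns (hH : PolyTime H) (hi : PolyTime i) (hs : PolyTime s) :
    PolyTime fun a => owns (H a) (i a) (s a) := by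
  have h : PolyTime fun x : α × (ℕ × (ℕ × ℕ)) => decide (x.2.2 = s x.1) :=
    decide_pair (snd.comp snd) (hs.comp fst)
  exact any (f := fun a (e : ℕ × (ℕ × ℕ)) => decide (e.2 = s a)) (filter_item hH hi).take_one h

theorem assigned (hH : PolyTime H) (hs : PolyTime s) :
    PolyTime fun a => assigned (H a) (s a) := by
  have h : PolyTime fun x : α × (ℕ × (ℕ × ℕ)) => SeqAlloc.owns (H x.1) x.2.1 (s x.1) :=
    owns (hH.comp fst) (fst.comp snd) (hs.comp fst)
  exact any (f := fun a (e : ℕ × (ℕ × ℕ)) => SeqAlloc.owns (H a) e.1 (s a)) hH h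

theorem _root_.SeqAlloc.size_nextBid_le (E H : List (ℕ × (ℕ × ℕ))) :
    size (nextBid E H) ≤ size E + 2 := by
  rcases nextBid_spec E H with ⟨h, _⟩ | ⟨e, h, he, _⟩
  · rw [h, size_nil]; omega
  · have := size_mem_lt he
    rw [h, size_cons, size_nil]
    omega

theorem nextBid (hE : PolyTime E) (hH : PolyTime H) : PolyTime fun a => nextBid (E a) (H a) := by
  have hany : PolyTime fun x : α × ((ℕ × (ℕ × ℕ)) × List (ℕ × (ℕ × ℕ))) => x.2.2.any
      fun e' => decide (SeqAlloc.price (H x.1) e'.1 < SeqAlloc.price (H x.1) x.2.1.1) := by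
    have hH' : PolyTime fun y : (α × ((ℕ × (ℕ × ℕ)) × List (ℕ × (ℕ × ℕ)))) × (ℕ × (ℕ × ℕ)) =>
      H y.1.1 := hH.comp (fst.comp fst)
    have h1 : PolyTime fun y : (α × ((ℕ × (ℕ × ℕ)) × List (ℕ × (ℕ × ℕ)))) × (ℕ × (ℕ × ℕ)) =>
      y.2.1 := fst.comp snd
    have h2 : PolyTime fun y : (α × ((ℕ × (ℕ × ℕ)) × List (ℕ × (ℕ × ℕ)))) × (ℕ × (ℕ × ℕ)) =>
      y.1.2.1.1 := fst.comp (fst.comp (snd.comp fst))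
    have ho : PolyTime fun x : α × ((ℕ × (ℕ × ℕ)) × List (ℕ × (ℕ × ℕ))) => x.2.2 :=
      snd.comp snd
    exact any (f := fun (x : α × ((ℕ × (ℕ × ℕ)) × List (ℕ × (ℕ × ℕ)))) (e' : ℕ × (ℕ × ℕ)) =>
      decide (SeqAlloc.price (H x.1) e'.1 < SeqAlloc.price (H x.1) x.2.1.1)) ho
      (lt (price hH' h1) (price hH' h2))
  have hass : PolyTime fun x : α × ((ℕ × (ℕ × ℕ)) × List (ℕ × (ℕ × ℕ))) =>
      SeqAlloc.assigned (H x.1) x.2.1.2 := assigned (hH.comp fst) (snd.comp (fst.comp snd))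
  have hstep : PolyTime fun x : α × ((ℕ × (ℕ × ℕ)) × List (ℕ × (ℕ × ℕ))) =>
      if SeqAlloc.assigned (H x.1) x.2.1.2 then x.2.2 else
      if x.2.2.any fun e' => decide (SeqAlloc.price (H x.1) e'.1 < SeqAlloc.price (H x.1) x.2.1.1)
      then x.2.2 else [x.2.1] :=
    cond hass (snd.comp snd) (cond hany (snd.comp snd) (cons (fst.comp snd) (const [])))
  refine foldr (f := fun a (e : ℕ × (ℕ × ℕ)) (o : List (ℕ × (ℕ × ℕ))) =>
    if SeqAlloc.assigned (H a) e.2 then o else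
    if o.any (fun e' => decide (SeqAlloc.price (H a) e'.1 < SeqAlloc.price (H a) e.1)) then o
      else [e]) hE (const []) hstep ?_
  · obtain ⟨q, hq⟩ := hE.size_le
    refine ⟨q + 2, fun a u v h => ?_⟩
    -- The fold over a suffix `v` is the next bid for the edges in `v`, which is at most one edge.
    have h1 : size (SeqAlloc.nextBid v (H a)) ≤ size v + 2 := size_nextBid_le v (H a)
    have h2 : size v ≤ size (E a) := by
      rw [h]
      exact size_sublist (List.sublist_append_right u v)
    have h3 := hq a
    simp only [Polynomial.eval_add, Polynomial.eval_ofNat]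
    exact h1.trans (by omega)

/-- There are polynomially many rounds, and each adds at most one edge to the history. -/
theorem matchable {L : α → List (ℕ × ℕ)} (hL : PolyTime L) (hE : PolyTime E) :
    PolyTime fun a => matchable (L a) (E a) := by
  have hiter : PolyTime fun a => (bidStep (E a))^[(E a).length * (E a).length + 1] [] := by
    refine iterate_of_add (g := fun a (H : List (ℕ × (ℕ × ℕ))) => bidStep (E a) H)
      (succ (mul (length hE) (length hE))) (const [])
      (append (nextBid (hE.comp fst) snd) snd) ?_
    obtain ⟨q, hq⟩ := hE.size_le
    refine ⟨q + 2, fun a c => ?_⟩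
    have h1 := size_nextBid_le (E a) c
    have h2 := size_append (SeqAlloc.nextBid (E a) c) c
    have h3 := hq a
    simp only [Polynomial.eval_add, Polynomial.eval_ofNat, bidStep]
    omega
  have h : PolyTime fun x : α × (ℕ × ℕ) => SeqAlloc.assigned
      ((bidStep (E x.1))^[(E x.1).length * (E x.1).length + 1] []) x.2 :=
    assigned (hiter.comp fst) snd
  exact all (f := fun a (s : ℕ × ℕ) =>
    SeqAlloc.assigned ((bidStep (E a))^[(E a).length * (E a).length + 1] []) s) hL h

end bids

end PolyTime

/-! ### The decision procedure

An instance is read as the list `w` of all its numbers. -/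

section decision

/-- Read a bit string as a list of numbers in tally notation. -/
def decode (l : List Bool) : List ℕ :=
  -- Read from the right, a zero opens a new number and a one increments the number opened last.
  l.foldr (fun b w => if b then (w.headD 0 + 1) :: w.tail else 0 :: w) []

/-- The number of agents. -/
def numAgents (w : List ℕ) : ℕ := w.getD 0 0

/-- The number of turns of each agent. -/
def numTurns (w : List ℕ) : ℕ := w.getD 1 0

/-- The number of items. -/
def numItems (w : List ℕ) : ℕ := numAgents w * numTurns w

/-- The distinguished agent. -/
def theAgent (w : List ℕ) : ℕ := w.getD (2 + numAgents w * numItems w) 0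

/-- The position of the item `i` in the ranking of the agent `c`. -/
def rank (w : List ℕ) (c i : ℕ) : ℕ := (w.drop (2 + c * numItems w)).idxOf i

/-- The turns of all agents other than `b` and the distinguished agent. -/
def slots (w : List ℕ) (b : ℕ) : List (ℕ × ℕ) :=
  ((List.range (numAgents w)).filter fun c => !decide (c = theAgent w) && !decide (c = b)).flatMap
    fun c => (List.range (numTurns w)).map fun j => (c, j)

/-- Each of these turns with the items that the agent prefers to the item `y`. -/
def edges (w : List ℕ) (b y : ℕ) : List (ℕ × (ℕ × ℕ)) :=
  (slots w b).flatMap fun s =>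
    ((List.range (numItems w)).filter fun i => decide (rank w s.1 i < rank w s.1 y)).map
      fun i => (i, s)

/-- Whether the agent `b` can get an item of the top set of the distinguished agent while `y` is
left. -/
def obstructs (w : List ℕ) (b y : ℕ) : Bool :=
  !decide (b = theAgent w) && (!decide (rank w (theAgent w) y < numTurns w) &&
    (((List.range (numItems w)).any fun t =>
      decide (rank w (theAgent w) t < numTurns w) && decide (rank w b t < rank w b y)) &&
    matchable (slots w b) (edges w b y)))

/-- The decision procedure for top-`k` NecessarySet. -/
def decideTop (l : List Bool) : Bool :=
  !((List.range (numAgents (decode l))).any fun b =>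
    (List.range (numItems (decode l))).any fun y => obstructs (decode l) b y)

/-- The decision procedure for NecessarySet. -/
def decideSet (l : List Bool) : Bool :=
  ((List.range (numItems (decode l))).all fun i =>
    l.getD (l.length - numItems (decode l) + i) false ==
      decide (rank (decode l) (theAgent (decode l)) i < numTurns (decode l))) && decideTop l

/-! ### The decision procedures run in polynomial time. -/

namespace PolyTime

variable {α : Type} [Enc α] {w : α → List ℕ}

theorem numAgents (hw : PolyTime w) : PolyTime fun a => numAgents (w a) :=
  getD hw (const 0) (const 0)

theorem numTurns (hw : PolyTime w) : PolyTime fun a => numTurns (w a) :=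
  getD hw (const 1) (const 0)

theorem numItems (hw : PolyTime w) : PolyTime fun a => numItems (w a) :=
  mul hw.numAgents hw.numTurns

theorem theAgent (hw : PolyTime w) : PolyTime fun a => theAgent (w a) :=
  getD hw (add (const 2) (mul hw.numAgents hw.numItems)) (const 0)

theorem rank {c i : α → ℕ} (hw : PolyTime w) (hc : PolyTime c) (hi : PolyTime i) :
    PolyTime fun a => rank (w a) (c a) (i a) :=
  idxOf hi (drop (add (const 2) (mul hc hw.numItems)) hw)

theorem slots {b : α → ℕ} (hw : PolyTime w) (hb : PolyTime b) :
    PolyTime fun a => slots (w a) (b a) := by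
  have h1 : PolyTime fun x : α × ℕ =>
      !decide (x.2 = SeqAlloc.theAgent (w x.1)) && !decide (x.2 = b x.1) :=
    and (eq snd (hw.theAgent.comp fst)).not (eq snd (hb.comp fst)).not
  have h2 : PolyTime fun x : α × ℕ =>
      (List.range (SeqAlloc.numTurns (w x.1))).map fun j => (x.2, j) :=
    map (f := fun (x : α × ℕ) (j : ℕ) => (x.2, j)) (hw.numTurns.comp fst).range
      ((snd.comp fst).pair snd)
  exact flatMap
    (f := fun a (c : ℕ) => (List.range (SeqAlloc.numTurns (w a))).map fun j => (c, j))
    (filter (f := fun a (c : ℕ) => !decide (c = SeqAlloc.theAgent (w a)) && !decide (c = b a))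
      hw.numAgents.range h1) h2

theorem edges {b y : α → ℕ} (hw : PolyTime w) (hb : PolyTime b) (hy : PolyTime y) :
    PolyTime fun a => edges (w a) (b a) (y a) := by
  have hw' : PolyTime fun x : (α × (ℕ × ℕ)) × ℕ => w x.1.1 := hw.comp (fst.comp fst)
  have hc : PolyTime fun x : (α × (ℕ × ℕ)) × ℕ => x.1.2.1 := fst.comp (snd.comp fst)
  have hy' : PolyTime fun x : (α × (ℕ × ℕ)) × ℕ => y x.1.1 := hy.comp (fst.comp fst)
  have h1 : PolyTime fun x : α × (ℕ × ℕ) => (List.range (SeqAlloc.numItems (w x.1))).filter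
      fun i => decide (SeqAlloc.rank (w x.1) x.2.1 i < SeqAlloc.rank (w x.1) x.2.1 (y x.1)) :=
    filter (f := fun (x : α × (ℕ × ℕ)) (i : ℕ) => decide (SeqAlloc.rank (w x.1) x.2.1 i <
      SeqAlloc.rank (w x.1) x.2.1 (y x.1))) (hw.numItems.comp fst).range
      (lt (rank hw' hc snd) (rank hw' hc hy'))
  exact flatMap (f := fun a (s : ℕ × ℕ) => ((List.range (SeqAlloc.numItems (w a))).filter fun i =>
    decide (SeqAlloc.rank (w a) s.1 i < SeqAlloc.rank (w a) s.1 (y a))).map fun i => (i, s))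
    (slots hw hb) (map (f := fun (x : α × (ℕ × ℕ)) (i : ℕ) => (i, x.2)) h1
      (snd.pair (snd.comp fst)))

theorem obstructs {b y : α → ℕ} (hw : PolyTime w) (hb : PolyTime b) (hy : PolyTime y) :
    PolyTime fun a => obstructs (w a) (b a) (y a) := by
  have hw' : PolyTime fun x : α × ℕ => w x.1 := hw.comp fst
  have hb' : PolyTime fun x : α × ℕ => b x.1 := hb.comp fst
  have hy' : PolyTime fun x : α × ℕ => y x.1 := hy.comp fst
  have h1 : PolyTime fun a => (List.range (SeqAlloc.numItems (w a))).any fun t =>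
      decide (SeqAlloc.rank (w a) (SeqAlloc.theAgent (w a)) t < SeqAlloc.numTurns (w a)) &&
        decide (SeqAlloc.rank (w a) (b a) t < SeqAlloc.rank (w a) (b a) (y a)) :=
    any (f := fun a (t : ℕ) =>
      decide (SeqAlloc.rank (w a) (SeqAlloc.theAgent (w a)) t < SeqAlloc.numTurns (w a)) &&
        decide (SeqAlloc.rank (w a) (b a) t < SeqAlloc.rank (w a) (b a) (y a)))
      hw.numItems.range
      (and (lt (rank hw' hw'.theAgent snd) hw'.numTurns) (lt (rank hw' hb' snd) (rank hw' hb' hy')))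
  exact and (eq hb hw.theAgent).not (and (lt (rank hw hw.theAgent hy) hw.numTurns).not
    (and h1 (matchable (slots hw hb) (edges hw hb hy))))

theorem decode : PolyTime decode := by
  have hw : PolyTime fun x : List Bool × (Bool × List ℕ) => x.2.2 := snd.comp snd
  have hstep : PolyTime fun x : List Bool × (Bool × List ℕ) =>
      if x.2.1 then (x.2.2.headD 0 + 1) :: x.2.2.tail else 0 :: x.2.2 :=
    cond (fst.comp snd) (cons (succ (headD hw (const 0))) (tail hw)) (cons (const 0) hw)
  refine foldr_of_add (f := fun (_ : List Bool) (b : Bool) (w : List ℕ) =>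
    if b then (w.headD 0 + 1) :: w.tail else 0 :: w) id' (const []) hstep ?_
  -- The largest growth occurs at a one on the empty list, where `[]` of size 1 becomes `[1]` of
  -- size 5.
  refine ⟨4, fun a b w _ => ?_⟩
  rw [Polynomial.eval_ofNat]
  cases b
  · simp [size_cons, size_nat]
    omega
  · rcases w with _ | ⟨i, w⟩
    · simp [size_cons, size_nat, size_nil]
    · simp [size_cons, size_nat]
      omega

theorem decideTop : PolyTime decideTop := by
  have h1 : PolyTime fun x : List Bool × ℕ => (List.range (SeqAlloc.numItems
      (SeqAlloc.decode x.1))).any fun y => SeqAlloc.obstructs (SeqAlloc.decode x.1) x.2 y :=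
    any (f := fun (x : List Bool × ℕ) (y : ℕ) => SeqAlloc.obstructs (SeqAlloc.decode x.1) x.2 y)
      (decode.comp fst).numItems.range
      (obstructs (decode.comp (fst.comp fst)) (snd.comp fst) snd)
  have h2 : PolyTime fun l => (List.range (SeqAlloc.numAgents (SeqAlloc.decode l))).any fun b =>
      (List.range (SeqAlloc.numItems (SeqAlloc.decode l))).any fun y =>
        SeqAlloc.obstructs (SeqAlloc.decode l) b y :=
    any (f := fun (l : List Bool) (b : ℕ) => (List.range (SeqAlloc.numItems
      (SeqAlloc.decode l))).any fun y => SeqAlloc.obstructs (SeqAlloc.decode l) b y)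
      decode.numAgents.range h1
  exact h2.not

theorem decideSet : PolyTime decideSet := by
  have hw : PolyTime fun x : List Bool × ℕ => SeqAlloc.decode x.1 := decode.comp fst
  have hl : PolyTime fun x : List Bool × ℕ => x.1 := fst
  have h1 : PolyTime fun x : List Bool × ℕ =>
      x.1.getD (x.1.length - SeqAlloc.numItems (SeqAlloc.decode x.1) + x.2) false ==
      decide (SeqAlloc.rank (SeqAlloc.decode x.1) (SeqAlloc.theAgent (SeqAlloc.decode x.1)) x.2 <
        SeqAlloc.numTurns (SeqAlloc.decode x.1)) :=
    beq_bool (getD hl (add (sub (length hl) hw.numItems) snd) (const false))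
      (lt (rank hw hw.theAgent snd) hw.numTurns)
  exact and (all (f := fun (l : List Bool) (i : ℕ) =>
    l.getD (l.length - SeqAlloc.numItems (SeqAlloc.decode l) + i) false ==
      decide (SeqAlloc.rank (SeqAlloc.decode l) (SeqAlloc.theAgent (SeqAlloc.decode l)) i <
        SeqAlloc.numTurns (SeqAlloc.decode l))) decode.numItems.range h1) decideTop

end PolyTime

end decision

/-! ### Correctness of the decision procedures -/

theorem decode_encodeNum (i : ℕ) (z : List Bool) : decode (encodeNum i ++ z) = i :: decode z := by
  induction i with
  | zero => rfl
  | succ i ih =>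
    have : decode (encodeNum (i + 1) ++ z) = ((decode (encodeNum i ++ z)).headD 0 + 1) ::
        (decode (encodeNum i ++ z)).tail := rfl
    rw [this, ih]
    rfl

theorem decode_flatMap {β : Type} (f : β → ℕ) (l : List β) (z : List Bool) :
    decode (l.flatMap (fun r => encodeNum (f r)) ++ z) = l.map f ++ decode z := by
  induction l with
  | nil => rfl
  | cons b l ih => rw [List.flatMap_cons, List.append_assoc, decode_encodeNum, ih]; rfl

theorem decode_flatMap_flatMap {β γ : Type} (f : β → γ → ℕ) (l : List β) (u : List γ)
    (z : List Bool) :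
    decode (l.flatMap (fun a => u.flatMap (fun r => encodeNum (f a r))) ++ z) =
      l.flatMap (fun a => u.map (f a)) ++ decode z := by
  induction l with
  | nil => rfl
  | cons b l ih =>
    rw [List.flatMap_cons, List.append_assoc, decode_flatMap, ih, List.flatMap_cons,
      List.append_assoc]

theorem drop_flatMap {β γ : Type} (f : β → List γ) (N : ℕ) (hf : ∀ b, (f b).length = N)
    (l : List β) (i : ℕ) : i ≤ l.length → ∀ z : List γ,
      (l.flatMap f ++ z).drop (i * N) = (l.drop i).flatMap f ++ z := by
  induction i generalizing l with
  | zero => intro _ z; simp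
  | succ i ih =>
    intro hi z
    rcases l with _ | ⟨b, l⟩
    · simp at hi
    · rw [List.flatMap_cons, List.append_assoc, Nat.add_mul, one_mul, Nat.add_comm,
        ← List.drop_drop, List.drop_left' (hf b)]
      exact ih l (by simpa using hi) z

section
variable (x : TopKInstance) (z : List Bool)

/-- The suffix `z` stands for the indicator vector of a target, and is empty for a top-k instance.
It decodes to meaningless numbers behind the distinguished agent, which do not influence the values
read off below. -/
theorem decode_encode : decode (x.encode ++ z) = x.n :: x.k ::
    ((List.finRange x.n).flatMap (fun a =>
      (List.finRange (x.n * x.k)).map (fun r => (x.P a r : ℕ))) ++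
      ((x.agent : ℕ) :: decode z)) := by
  simp only [TopKInstance.encode, List.append_assoc, decode_encodeNum]
  rw [decode_flatMap_flatMap (fun a r => (x.P a r : ℕ)), decode_encodeNum]

theorem numAgents_decode : numAgents (decode (x.encode ++ z)) = x.n := by
  rw [decode_encode]; rfl

theorem numTurns_decode : numTurns (decode (x.encode ++ z)) = x.k := by
  rw [decode_encode]; rfl

theorem numItems_decode : numItems (decode (x.encode ++ z)) = x.n * x.k := by
  rw [numItems, numAgents_decode, numTurns_decode]

theorem drop_decode (i : ℕ) (hi : i ≤ x.n) :
    (decode (x.encode ++ z)).drop (2 + i * (x.n * x.k)) =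
      ((List.finRange x.n).drop i).flatMap (fun a =>
        (List.finRange (x.n * x.k)).map (fun r => (x.P a r : ℕ))) ++
        ((x.agent : ℕ) :: decode z) := by
  rw [decode_encode, Nat.add_comm, List.drop_succ_cons, List.drop_succ_cons,
    drop_flatMap _ (x.n * x.k) (by simp) _ _ (by simpa using hi)]

theorem theAgent_decode : theAgent (decode (x.encode ++ z)) = x.agent := by
  rw [theAgent, numItems_decode, numAgents_decode, List.getD_eq_getElem?_getD,
    ← List.head?_drop, drop_decode _ _ _ le_rfl, List.drop_of_length_le (by simp)]
  rfl

/-- The list searched by `rank` runs on beyond the ranking of `c`. As that ranking contains every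
item, the first occurrence already lies within it. -/
theorem rank_decode (c : Fin x.n) (o : Fin (x.n * x.k)) :
    rank (decode (x.encode ++ z)) c o = (x.P c).symm o := by
  rw [rank, numItems_decode, drop_decode _ _ _ c.2.le,
    List.drop_eq_getElem_cons (by simp), List.flatMap_cons, List.append_assoc,
    List.getElem_finRange]
  set l := (List.finRange (x.n * x.k)).map (fun r => (x.P c r : ℕ)) with hl
  have hnd : l.Nodup := (List.nodup_finRange _).map fun r r' h =>
    (x.P c).injective (Fin.ext h)
  have hlen : ((x.P c).symm o : ℕ) < l.length := by simp [hl]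
  have hget : l[((x.P c).symm o : ℕ)] = o := by simp [hl]
  have hmem : (o : ℕ) ∈ l := hget ▸ List.getElem_mem hlen
  have := hnd.idxOf_getElem _ hlen
  rw [hget] at this
  rw [← this]
  exact List.idxOf_append_of_mem hmem

theorem mem_slots {w : List ℕ} {b : ℕ} {s : ℕ × ℕ} : s ∈ slots w b ↔
    s.1 < numAgents w ∧ s.1 ≠ theAgent w ∧ s.1 ≠ b ∧ s.2 < numTurns w := by
  obtain ⟨c, j⟩ := s
  simp [slots]
  tauto

theorem mem_edges {w : List ℕ} {b y i : ℕ} {s : ℕ × ℕ} : (i, s) ∈ edges w b y ↔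
    s ∈ slots w b ∧ i < numItems w ∧ rank w s.1 i < rank w s.1 y := by
  simp [edges]

theorem matchable_slots_iff (b : Fin x.n) (y : Fin (x.n * x.k)) :
    matchable (slots (decode (x.encode ++ z)) b) (edges (decode (x.encode ++ z)) b y) = true ↔
    ∃ g : Fin x.n × Fin x.k → Fin (x.n * x.k),
        Set.InjOn g {s | s.1 ≠ x.agent ∧ s.1 ≠ b} ∧
        ∀ s, s.1 ≠ x.agent → s.1 ≠ b → (x.P s.1).symm (g s) < (x.P s.1).symm y := by
  rw [matchable_iff fun e he => (mem_edges.1 he).1]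
  simp only [mem_edges, mem_slots, numAgents_decode, numTurns_decode, theAgent_decode,
    numItems_decode]
  constructor
  · rintro ⟨g, hg, hinj⟩
    let f : Fin x.n × Fin x.k → ℕ × ℕ := fun s => (s.1, s.2)
    have hf : ∀ s, s.1 ≠ x.agent → s.1 ≠ b → ((f s).1 < x.n ∧ (f s).1 ≠ x.agent ∧ (f s).1 ≠ b ∧
        (f s).2 < x.k) := fun s h1 h2 =>
      ⟨s.1.2, fun h => h1 (Fin.ext h), fun h => h2 (Fin.ext h), s.2.2⟩
    -- On the relevant slots `g` takes values in the range of the items; the default `y` only makes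
    -- the map total.
    refine ⟨fun s => if h : g (f s) < x.n * x.k then ⟨g (f s), h⟩ else y, ?_, ?_⟩
    · rintro s ⟨hs1, hs2⟩ t ⟨ht1, ht2⟩ hst
      have h1 := hf s hs1 hs2
      have h2 := hf t ht1 ht2
      simp only [(hg _ h1).2.1, (hg _ h2).2.1, dif_pos, Fin.mk.injEq] at hst
      have := hinj h1 h2 hst
      simp only [f, Prod.mk.injEq, Fin.val_inj] at this
      exact Prod.ext this.1 this.2
    · intro s hs1 hs2
      obtain ⟨_, h2, h3⟩ := hg _ (hf s hs1 hs2)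
      simp only [h2, dif_pos]
      have h4 := rank_decode x z s.1 ⟨g (f s), h2⟩
      have h5 := rank_decode x z s.1 y
      rw [Fin.lt_def, ← h4, ← h5]
      exact h3
  · rintro ⟨g, hinj, hg⟩
    have hval : ∀ s : ℕ × ℕ, (s.1 < x.n ∧ s.1 ≠ x.agent ∧ s.1 ≠ b ∧ s.2 < x.k) →
        ∃ t : Fin x.n × Fin x.k, t.1 ≠ x.agent ∧ t.1 ≠ b ∧ s = (↑t.1, ↑t.2) := fun s hs =>
      ⟨(⟨s.1, hs.1⟩, ⟨s.2, hs.2.2.2⟩), fun h => hs.2.1 (congrArg Fin.val h),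
        fun h => hs.2.2.1 (congrArg Fin.val h), rfl⟩
    let f : ℕ × ℕ → ℕ := fun s =>
      if h : s.1 < x.n ∧ s.2 < x.k then g (⟨s.1, h.1⟩, ⟨s.2, h.2⟩) else 0
    have hf : ∀ t : Fin x.n × Fin x.k, f (↑t.1, ↑t.2) = g t := fun t =>
      dif_pos ⟨t.1.2, t.2.2⟩
    refine ⟨f, fun s hs => ?_, fun s hs s' hs' h => ?_⟩
    · obtain ⟨t, ht1, ht2, rfl⟩ := hval s hs
      refine ⟨hs, ?_, ?_⟩
      · rw [hf]; exact (g t).2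
      · rw [hf, rank_decode, rank_decode]
        exact hg t ht1 ht2
    · obtain ⟨t, ht1, ht2, rfl⟩ := hval s hs
      obtain ⟨t', ht1', ht2', rfl⟩ := hval s' hs'
      rw [hf, hf] at h
      rw [hinj ⟨ht1, ht2⟩ ⟨ht1', ht2'⟩ (Fin.ext h)]

theorem obstructs_iff (b : Fin x.n) (y : Fin (x.n * x.k)) :
    obstructs (decode (x.encode ++ z)) b y = true ↔
    b ≠ x.agent ∧ y ∉ topItems x.P x.agent x.k ∧
      (∃ t ∈ topItems x.P x.agent x.k, (x.P b).symm t < (x.P b).symm y) ∧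
      ∃ g : Fin x.n × Fin x.k → Fin (x.n * x.k),
        Set.InjOn g {s | s.1 ≠ x.agent ∧ s.1 ≠ b} ∧
        ∀ s, s.1 ≠ x.agent → s.1 ≠ b → (x.P s.1).symm (g s) < (x.P s.1).symm y := by
  rw [obstructs, Bool.and_eq_true, Bool.and_eq_true, Bool.and_eq_true, matchable_slots_iff,
    theAgent_decode, numTurns_decode, numItems_decode, rank_decode, rank_decode]
  refine and_congr (by simp [Fin.ext_iff]) (and_congr (by simp [mem_topItems])
    (and_congr ?_ Iff.rfl))
  simp only [List.any_eq_true, List.mem_range, Bool.and_eq_true, decide_eq_true_eq]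
  constructor
  · rintro ⟨t, ht, h1, h2⟩
    have e1 := rank_decode x z x.agent ⟨t, ht⟩
    have e2 := rank_decode x z b ⟨t, ht⟩
    simp only at e1 e2
    rw [e1] at h1
    rw [e2] at h2
    exact ⟨⟨t, ht⟩, mem_topItems.2 h1, h2⟩
  · rintro ⟨t, h1, h2⟩
    refine ⟨t, t.2, ?_, ?_⟩
    · rw [rank_decode]; exact mem_topItems.1 h1
    · rw [rank_decode]; exact h2

theorem decideTop_iff : decideTop (x.encode ++ z) = true ↔ TopKNecessarySetBalanced x := by
  have h : TopKNecessarySetBalanced x ↔ ¬ ∃ π ∈ balancedPolicies x.n (x.n * x.k),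
      bundle x.P π x.agent ≠ topItems x.P x.agent x.k := by
    simp [TopKNecessarySetBalanced]
  rw [h, exists_bundle_ne_topItems_iff, decideTop, Bool.not_eq_true', ← Bool.not_eq_true]
  refine not_congr ?_
  simp only [List.any_eq_true, List.mem_range, numAgents_decode, numItems_decode]
  constructor
  · rintro ⟨b, hb, y, hy, h⟩
    obtain ⟨h1, h2⟩ := (obstructs_iff x z ⟨b, hb⟩ ⟨y, hy⟩).1 h
    exact ⟨_, h1, _, h2⟩
  · rintro ⟨b, h1, y, h2⟩
    exact ⟨b, b.2, y, y.2, (obstructs_iff x z b y).2 ⟨h1, h2⟩⟩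

end

/-- Some balanced policy gives the agent her top items, so a set she always gets must be the top
set. -/
theorem necessarySet_iff (x : SetInstance) : NecessarySetBalanced x ↔
    x.target = topItems x.P x.agent x.k ∧ TopKNecessarySetBalanced x.toTopKInstance := by
  constructor
  · intro h
    obtain ⟨π, hπ, he⟩ := exists_bundle_eq_topItems x.P x.agent
    have ht : x.target = topItems x.P x.agent x.k := (h π hπ).symm.trans he
    exact ⟨ht, fun π hπ => (h π hπ).trans ht⟩
  · rintro ⟨h1, h2⟩ π hπ
    exact (h2 π hπ).trans h1.symm

theorem decideSet_iff (x : SetInstance) : decideSet x.encode = true ↔ NecessarySetBalanced x := by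
  rw [necessarySet_iff, decideSet, Bool.and_eq_true, SetInstance.encode, decideTop_iff]
  refine and_congr ?_ Iff.rfl
  simp only [List.all_eq_true, List.mem_range, numItems_decode, theAgent_decode, numTurns_decode,
    List.length_append, List.length_map, List.length_finRange, Nat.add_sub_cancel, beq_iff_eq]
  have key : ∀ o : Fin (x.n * x.k), (x.toTopKInstance.encode ++
      (List.finRange (x.n * x.k)).map (fun o => decide (o ∈ x.target))).getD
        (x.toTopKInstance.encode.length + o) false = decide (o ∈ x.target) := by
    intro o
    rw [List.getD_append_right _ _ _ _ (Nat.le_add_right _ _), Nat.add_sub_cancel_left,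
      List.getD_eq_getElem _ _ (by simp)]
    simp
  constructor
  · intro h
    ext o
    have := h o o.2
    rw [key, rank_decode, decide_eq_decide] at this
    rw [this, mem_topItems]
  · intro h i hi
    have h1 := key ⟨i, hi⟩
    have h2 := rank_decode x.toTopKInstance ((List.finRange (x.n * x.k)).map
      (fun o => decide (o ∈ x.target))) x.agent ⟨i, hi⟩
    simp only at h1 h2
    rw [h1, h2, decide_eq_decide, h, mem_topItems]

end SeqAlloc

theorem mainTheorem6 :
    SeqAlloc.InP SeqAlloc.SetInstance.encode SeqAlloc.NecessarySetBalanced ∧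
    SeqAlloc.InP SeqAlloc.TopKInstance.encode SeqAlloc.TopKNecessarySetBalanced :=
  ⟨SeqAlloc.inP_of_polyTime SeqAlloc.PolyTime.decideSet SeqAlloc.decideSet_iff,
    SeqAlloc.inP_of_polyTime SeqAlloc.PolyTime.decideTop fun x => by
      simpa using SeqAlloc.decideTop_iff x []⟩
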